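/- Let $\Omega\subset\mathbb R^3$ be a bounded open set and $T>0$. For a vector field $u$ write $(\nabla u)_{ij}=\partial_j u_i$, $(\nabla u)_{\rm skw}=\frac12(\nabla u-(\nabla u)^T)$, $(\operatorname{div}M)_i=\sum_j\partial_jM_{ij}$ for a matrix field $M$, $a\otimes b=ab^T$, and let $|\cdot|$ be the Euclidean (Frobenius) norm. Let $v:\overline\Omega\to\mathbb R^3$ be a prescribed time-independent velocity field (for instance a constant one), continuously differentiable on $\overline\Omega$, with $\operatorname{div}v=0$ in $\Omega$. For the nonconvex energy $F[d]=\frac12\int_\Omega|\nabla d|^2\,dx+\frac12\int_\Omega|(\nabla d)_{\rm skw}d|^2\,dx$ consider in $(0,T)\times\Omega$ the equation $$\partial_t d+(v\cdot\nabla)d=-\frac{\delta F}{\delta d}[d]=\Delta d+\operatorname{div}\big((\nabla d)_{\rm skw}d\otimes d\big)_{\rm skw}-(\nabla d)_{\rm skw}^T(\nabla d)_{\rm skw}d .$$ There is a constant $c>0$ with the Poincaré inequality $\int_\Omega|w|^2dx\le c\int_\Omega|\nabla w|^2dx$ for all vector fields $w$ that are continuous on $\overline\Omega$, continuously differentiable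 with bounded gradient in $\Omega$, and zero on $\partial\Omega$. For every such $c$ the following holds. Let $d$ and $\tilde d$ be two solutions that are sufficiently smooth, in the sense that $d,\nabla d,\nabla^2d,\partial_td,\nabla\partial_td$ exist and are continuous on $[0,T]\times\overline\Omega$, and likewise for $\tilde d$, and that have the same time-independent Dirichlet boundary values on $\partial\Omega$. Put $$\mathcal E[d|\tilde d]=\frac12\int_\Omega|\nabla d-\nabla\tilde d|^2dx+\frac12\int_\Omega|(\nabla d)_{\rm skw}d-(\nabla\tilde d)_{\rm skw}\tilde d|^2dx .$$ Then for all $t\in[0,T]$ $$\begin{aligned}\mathcal E[d(t)|\tilde d(t)]\le{}&2\Big(\mathcal E[d(0)|\tilde d(0)]+\max_{\overline\Omega\times[0,T]}|(\nabla\tilde d)_{\rm skw}\tilde d|^2\int_\Omega|d(0)-\tilde d(0)|^2dx\\&+\int_\Omega\big|(d(0)-\tilde d(0))\cdot((\nabla d(0))_{\rm skw}-(\nabla\tilde d(0))_{\rm skw})^T(\nabla\tilde d(0))_{\rm skw}\tilde d(0)\big|dx\Big)e^{\mathcal K(t)},\end{aligned}$$ where $$\mathcal K(t)=4ct\max_{\overline\Omega\times[0,T]}|(\nabla\tilde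 d)_{\rm skw}\tilde d|^4+2(1+c)\int_0^t\max_{x\in\overline\Omega}\big(|\tilde d||\nabla\partial_t\tilde d|+|\nabla\tilde d||\partial_t\tilde d|+|\nabla\partial_t\tilde d|+|\partial_t\tilde d|+|v|^2\big)ds .$$ Moreover, if $d(0)=\tilde d(0)$ in $\Omega$, then $d=\tilde d$ on $[0,T]\times\overline\Omega$. -/

import Mathlib

open Set MeasureTheory
open scoped Matrix

noncomputable section

namespace Director

/-- Euclidean three-space. -/
abbrev E := EuclideanSpace ℝ (Fin 3)

/-- Real 3×3 matrices. -/
abbrev M3 := Matrix (Fin 3) (Fin 3) ℝ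

/-- The Frobenius norm `|A| = (A : A)^(1/2)`. -/
def frob (A : M3) : ℝ := Real.sqrt (∑ i, ∑ j, A i j ^ 2)

/-- The skew-symmetric part of a matrix. -/
def skw (A : M3) : M3 := (1 / 2 : ℝ) • (A - Aᵀ)

/-- The product of a matrix and a vector of Euclidean space. -/
def act (A : M3) (u : E) : E := WithLp.toLp 2 (A *ᵥ u.ofLp)

/-- The dyadic product `a ⊗ b = a bᵀ`. -/
def dyad (a b : E) : M3 := Matrix.vecMulVec a.ofLp b.ofLp

/-- The gradient `(∇u)_{ij} = ∂_j u_i` on the closure of the open set `Ω`. At the points of `Ω`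
it is the ordinary gradient; at the points of a regular boundary it is the one-sided one. -/
def grad (Ω : Set E) (u : E → E) (x : E) : M3 :=
  Matrix.of fun i j => (fderivWithin ℝ u (closure Ω) x (EuclideanSpace.single j 1)) i

/-- The divergence of a vector field. -/
def vdiv (Ω : Set E) (u : E → E) (x : E) : ℝ := (grad Ω u x).trace

/-- The row-wise divergence `(div M)_i = ∑_j ∂_j M_{ij}` of a matrix field. -/
def mdiv (Ω : Set E) (M : E → M3) (x : E) : E :=
  WithLp.toLp 2 fun i =>
    ∑ j, fderivWithin ℝ (fun y => M y i j) (closure Ω) x (EuclideanSpace.single j 1)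

/-- `(∇u)_skw u`. -/
def bend (Ω : Set E) (u : E → E) (x : E) : E := act (skw (grad Ω u x)) (u x)

/-- The variational derivative of
`F[u] = ½ ∫_Ω |∇u|² + ½ ∫_Ω |(∇u)_skw u|²`, namely
`δF/δu [u] = - Δu - div (((∇u)_skw u ⊗ u)_skw) + ((∇u)_skw)ᵀ (∇u)_skw u`,
where `Δu = div ∇u`. -/
def varDeriv (Ω : Set E) (u : E → E) (x : E) : E :=
  - mdiv Ω (grad Ω u) x
    - mdiv Ω (fun y => skw (dyad (bend Ω u y) (u y))) x
    + act (skw (grad Ω u x))ᵀ (bend Ω u x)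

/-- The time derivative on `[0,T]`, one-sided at the end points. -/
def dt (T : ℝ) (d : ℝ → E → E) (t : ℝ) (x : E) : E :=
  derivWithin (fun s => d s x) (Icc 0 T) t

/-- The regularity of classical solutions: `d`, `∇d`, `∇²d`, `∂_t d` and `∇∂_t d` exist and are
continuous on `[0,T] × closure Ω`. -/
structure IsRegular (Ω : Set E) (T : ℝ) (d : ℝ → E → E) : Prop where
  cont : ContinuousOn (fun q : ℝ × E => d q.1 q.2) (Icc 0 T ×ˢ closure Ω)
  diff_space : ∀ t ∈ Icc 0 T, DifferentiableOn ℝ (d t) (closure Ω)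
  cont_grad : ContinuousOn (fun q : ℝ × E => fderivWithin ℝ (d q.1) (closure Ω) q.2)
    (Icc 0 T ×ˢ closure Ω)
  diff_grad : ∀ t ∈ Icc 0 T, DifferentiableOn ℝ (fderivWithin ℝ (d t) (closure Ω)) (closure Ω)
  cont_hess : ContinuousOn
    (fun q : ℝ × E => fderivWithin ℝ (fderivWithin ℝ (d q.1) (closure Ω)) (closure Ω) q.2)
    (Icc 0 T ×ˢ closure Ω)
  diff_time : ∀ x ∈ closure Ω, DifferentiableOn ℝ (fun t => d t x) (Icc 0 T)
  cont_dt : ContinuousOn (fun q : ℝ × E => dt T d q.1 q.2) (Icc 0 T ×ˢ closure Ω)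
  diff_dt : ∀ t ∈ Icc 0 T, DifferentiableOn ℝ (dt T d t) (closure Ω)
  cont_grad_dt : ContinuousOn (fun q : ℝ × E => fderivWithin ℝ (dt T d q.1) (closure Ω) q.2)
    (Icc 0 T ×ˢ closure Ω)

/-- A prescribed velocity: a time-independent solenoidal field, continuously differentiable up to
the boundary. Every constant field is one. -/
structure IsVelocity (Ω : Set E) (v : E → E) : Prop where
  diff : DifferentiableOn ℝ v (closure Ω)
  cont_fderiv : ContinuousOn (fderivWithin ℝ v (closure Ω)) (closure Ω)
  solenoidal : ∀ x ∈ Ω, vdiv Ω v x = 0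

/-- `d` is a regular solution of `∂_t d + (v·∇) d = - δF/δd [d]` in `(0,T) × Ω` with the
time-independent Dirichlet boundary values `g`; here `(v·∇) d = (∇d) v`. -/
structure IsSolution (Ω : Set E) (T : ℝ) (v g : E → E) (d : ℝ → E → E) : Prop where
  regular : IsRegular Ω T d
  equation : ∀ t ∈ Ioo 0 T, ∀ x ∈ Ω,
    dt T d t x + act (grad Ω (d t) x) (v x) = - varDeriv Ω (d t) x
  boundary : ∀ t ∈ Icc 0 T, ∀ x ∈ frontier Ω, d t x = g x

/-- `c` is a constant of the Poincaré inequality `∫_Ω |w|² ≤ c ∫_Ω |∇w|²` for vector fields `w`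
with zero boundary values. -/
def IsPoincareConstant (Ω : Set E) (c : ℝ) : Prop :=
  0 < c ∧ ∀ w : E → E, ContinuousOn w (closure Ω) → ContDiffOn ℝ 1 w Ω →
    (∃ B : ℝ, ∀ x ∈ Ω, ‖fderiv ℝ w x‖ ≤ B) → (∀ x ∈ frontier Ω, w x = 0) →
    (∫ x in Ω, ‖w x‖ ^ 2) ≤ c * (∫ x in Ω, frob (grad Ω w x) ^ 2)

/-- The relative energy of two director fields. -/
def relEnergy (Ω : Set E) (u u' : E → E) : ℝ :=
  (1 / 2) * (∫ x in Ω, frob (grad Ω u x - grad Ω u' x) ^ 2)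
    + (1 / 2) * (∫ x in Ω, ‖bend Ω u x - bend Ω u' x‖ ^ 2)

/-- The maximum of a function over a set (it is only used for continuous functions on compact
sets). -/
def maxOver {α : Type*} (S : Set α) (f : α → ℝ) : ℝ := sSup (f '' S)

/-- The exponent
`K(t) = 4 c t max |(∇d')_skw d'|⁴ + 2 (1 + c) ∫₀ᵗ max_x (|d'| |∇∂_t d'| + |∇d'| |∂_t d'|
  + |∇∂_t d'| + |∂_t d'| + |v|²) ds`. -/
def exponent (Ω : Set E) (T c : ℝ) (v : E → E) (d' : ℝ → E → E) (t : ℝ) : ℝ :=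
  4 * c * t * maxOver (Icc 0 T ×ˢ closure Ω) (fun q : ℝ × E => ‖bend Ω (d' q.1) q.2‖ ^ 4)
    + 2 * (1 + c) * (∫ s in (0 : ℝ)..t, maxOver (closure Ω) (fun x =>
        ‖d' s x‖ * frob (grad Ω (dt T d' s) x) + frob (grad Ω (d' s) x) * ‖dt T d' s x‖
          + frob (grad Ω (dt T d' s) x) + ‖dt T d' s x‖ + ‖v x‖ ^ 2))

end Director

end

noncomputable section

namespace Director

open Filter Topology NNReal

/-! Write `w = d - d'`, `P = ∇d - ∇d'`, `b` and `b'` for the two values of `(∇·)_skw ·`, and `β = b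
- b'`. Differentiating the relative energy in time produces `∇∂_t d`, for which no bound may enter
the estimate. The remedy is to add `⟨b', P_skw w⟩ + m |w|²` to the density, with `m = max |b'|²`. By
`energy_algebra`, the derivative of the quadratic part together with this cross term equals the
difference of the two weak equations tested with `∂_t w`, up to terms in which the only time
derivatives are those of `d'`, and the term `2m ⟨w, ∂_t w⟩`. The tested equations contribute `-|∂_t
w|² - ⟨∂_t w, P v⟩`; the square absorbs both the transport term and `2m ⟨w, ∂_t w⟩`
(`dissipation_bound`).

The correction is harmless. A skew matrix acts as a cross product, so `|P_skw w|² ≤ ½ |P|² |w|²`,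
and the corrected density stays above `⅜ |P|² + ½ |β|²` (`density_lower_bound`). With the Poincaré
inequality for `w` this turns the estimate into a linear differential inequality for the corrected
energy (`integral_densityDeriv_le`). Gronwall's inequality, the lower bound at time `t` and an upper
bound at time `0` give the claim. If the initial values agree, the right-hand side vanishes, and the
Poincaré inequality gives `w = 0`.

Since `Ω` is any bounded open set, integration by parts is proved without traces: a function with
bounded gradient which vanishes on the boundary extends by zero to a Lipschitz function, and the
derivative of a compactly supported Lipschitz function has integral zero. The existence of a
Poincaré constant follows from the same fact. -/

/-- The Frobenius inner product `A : B` of matrices. -/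
def ddot (A B : M3) : ℝ := ∑ i, ∑ j, A i j * B i j

/-! ### Algebra of the Frobenius product and of the skew part -/

lemma frob_nonneg (A : M3) : 0 ≤ frob A := Real.sqrt_nonneg _

lemma frob_sq (A : M3) : frob A ^ 2 = ddot A A := by
  have h : 0 ≤ ∑ i, ∑ j, A i j ^ 2 :=
    Finset.sum_nonneg fun i _ => Finset.sum_nonneg fun j _ => sq_nonneg _
  exact (Real.sq_sqrt h).trans (by simp only [ddot, sq])

lemma ddot_add_left (A B C : M3) : ddot (A + B) C = ddot A C + ddot B C := by
  simp [ddot, add_mul, Finset.sum_add_distrib]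

lemma ddot_sub_left (A B C : M3) : ddot (A - B) C = ddot A C - ddot B C := by
  simp [ddot, sub_mul, Finset.sum_sub_distrib]

lemma inner_eq_sum (a b : E) : inner ℝ a b = ∑ i, a i * b i := by
  simp [PiLp.inner_apply, mul_comm]

lemma act_apply (A : M3) (u : E) (i : Fin 3) : act A u i = ∑ j, A i j * u j := rfl

lemma act_sub_left (A B : M3) (u : E) : act (A - B) u = act A u - act B u := by
  ext i; simp [act_apply, sub_mul, Finset.sum_sub_distrib]

lemma act_sub_right (A : M3) (u v : E) : act A (u - v) = act A u - act A v := by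
  ext i; simp [act_apply, mul_sub, Finset.sum_sub_distrib]

lemma skw_sub (A B : M3) : skw (A - B) = skw A - skw B := by
  ext i j; simp [skw]; ring

lemma skw_apply (A : M3) (i j : Fin 3) : skw A i j = 1 / 2 * (A i j - A j i) := by
  simp [skw]

lemma ddot_skw (A B : M3) : ddot (skw A) B = ddot A (skw B) := by
  simp only [ddot, skw_apply, Fin.sum_univ_three]; ring

lemma ddot_dyad (a b : E) (A : M3) : ddot (dyad a b) A = inner ℝ a (act A b) := by
  simp only [ddot, dyad, Matrix.vecMulVec_apply, inner_eq_sum, act_apply, Fin.sum_univ_three]; ring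

lemma inner_act_transpose (A : M3) (a b : E) : inner ℝ a (act Aᵀ b) = inner ℝ b (act A a) := by
  simp only [inner_eq_sum, act_apply, Fin.sum_univ_three, Matrix.transpose_apply]; ring

lemma norm_sq_eq_sum (a : E) : ‖a‖ ^ 2 = ∑ i, a i ^ 2 := by
  rw [EuclideanSpace.norm_sq_eq]; simp

lemma norm_act_le (A : M3) (u : E) : ‖act A u‖ ≤ frob A * ‖u‖ := by
  refine abs_le_of_sq_le_sq' ?_ (mul_nonneg (frob_nonneg _) (norm_nonneg _)) |>.2
  rw [mul_pow, frob_sq, norm_sq_eq_sum, norm_sq_eq_sum, ddot, Finset.sum_mul]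
  refine Finset.sum_le_sum fun i _ => ?_
  simpa only [act_apply, sq] using
    by simpa only [sq] using Finset.sum_mul_sq_le_sq_mul_sq Finset.univ (fun j => A i j) (fun j => u j)

/-- A skew part acts as a cross product, which gains the factor `1/2`. -/
lemma norm_act_skw_sq_le (A : M3) (u : E) :
    ‖act (skw A) u‖ ^ 2 ≤ 1 / 2 * frob A ^ 2 * ‖u‖ ^ 2 := by
  rw [frob_sq, norm_sq_eq_sum, norm_sq_eq_sum]
  simp only [act_apply, skw_apply, ddot, Fin.sum_univ_three]
  set x := u 0
  set y := u 1
  set z := u 2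
  set a := (A 0 1 - A 1 0) / 2 with ha
  set b := (A 0 2 - A 2 0) / 2 with hb
  set c := (A 1 2 - A 2 1) / 2 with hc
  have h1 : (a ^ 2 + b ^ 2 + c ^ 2) ≤ 1 / 2 * (A 0 0 * A 0 0 + A 0 1 * A 0 1 + A 0 2 * A 0 2 +
      (A 1 0 * A 1 0 + A 1 1 * A 1 1 + A 1 2 * A 1 2) +
      (A 2 0 * A 2 0 + A 2 1 * A 2 1 + A 2 2 * A 2 2)) := by
    rw [ha, hb, hc]
    nlinarith [sq_nonneg (A 0 1 + A 1 0), sq_nonneg (A 0 2 + A 2 0), sq_nonneg (A 1 2 + A 2 1),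
      sq_nonneg (A 0 0), sq_nonneg (A 1 1), sq_nonneg (A 2 2)]
  refine le_trans ?_ (mul_le_mul_of_nonneg_right h1 (by positivity))
  have e : (1 / 2 * (A 0 0 - A 0 0) * x + 1 / 2 * (A 0 1 - A 1 0) * y + 1 / 2 * (A 0 2 - A 2 0) * z)
      = a * y + b * z := by rw [ha, hb]; ring
  have e1 : (1 / 2 * (A 1 0 - A 0 1) * x + 1 / 2 * (A 1 1 - A 1 1) * y + 1 / 2 * (A 1 2 - A 2 1) * z)
      = - a * x + c * z := by rw [ha, hc]; ring
  have e2 : (1 / 2 * (A 2 0 - A 0 2) * x + 1 / 2 * (A 2 1 - A 1 2) * y + 1 / 2 * (A 2 2 - A 2 2) * z)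
      = - b * x - c * y := by rw [hb, hc]; ring
  rw [e, e1, e2]
  -- Lagrange's identity: the difference of the two sides is exactly `(a z - b y + c x)²`.
  nlinarith [sq_nonneg (a * z - b * y + c * x)]

lemma frob_skw_le (A : M3) : frob (skw A) ≤ frob A := by
  refine Real.sqrt_le_sqrt ?_
  simp only [skw_apply, Fin.sum_univ_three]
  nlinarith [sq_nonneg (A 0 1 + A 1 0), sq_nonneg (A 0 2 + A 2 0), sq_nonneg (A 1 2 + A 2 1),
      sq_nonneg (A 0 0), sq_nonneg (A 1 1), sq_nonneg (A 2 2)]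

lemma norm_act_skw_le (A : M3) (u : E) : ‖act (skw A) u‖ ≤ frob A * ‖u‖ :=
  (norm_act_le _ _).trans (mul_le_mul_of_nonneg_right (frob_skw_le A) (norm_nonneg _))

@[fun_prop] lemma continuous_skw : Continuous skw := by
  unfold skw; fun_prop

@[fun_prop] lemma continuous_act : Continuous fun q : M3 × E => act q.1 q.2 := by
  unfold act; fun_prop

@[fun_prop] lemma continuous_frob : Continuous frob := by
  unfold frob; fun_prop

@[fun_prop] lemma continuous_ddot : Continuous fun q : M3 × M3 => ddot q.1 q.2 := by
  unfold ddot; fun_prop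

/-! ### Pointwise identity and estimates for the energy density -/

/-- The pointwise algebra behind the relative energy identity. -/
lemma energy_algebra (A A' Q Q' : M3) (u u' z z' : E) :
    inner ℝ (act (skw A) u - act (skw A') u')
        (act (skw Q) u + act (skw A) z - (act (skw Q') u' + act (skw A') z'))
      + (inner ℝ (act (skw A') u')
          (act (skw Q - skw Q') (u - u') + act (skw A - skw A') (z - z')))
    = ddot (skw (dyad (act (skw A) u) u) - skw (dyad (act (skw A') u') u')) (Q - Q')
      + inner ℝ (z - z') (act (skw A)ᵀ (act (skw A) u) - act (skw A')ᵀ (act (skw A') u'))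
      + inner ℝ (act (skw A) u - act (skw A') u')
          (act (skw Q') (u - u') + act (skw A - skw A') z') := by
  rw [ddot_sub_left, ddot_skw, ddot_skw, ddot_dyad, ddot_dyad,
    inner_sub_right (z - z'), inner_act_transpose, inner_act_transpose]
  simp only [skw_sub, act_sub_left, act_sub_right, inner_sub_left, inner_sub_right,
    inner_add_right]
  ring

/-- The coercivity of the relative energy density. -/
lemma density_lower_bound (P : M3) (w b β : E) {m : ℝ} (hb : ‖b‖ ^ 2 ≤ m) :
    3 / 8 * frob P ^ 2 + 1 / 2 * ‖β‖ ^ 2 ≤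
      1 / 2 * frob P ^ 2 + 1 / 2 * ‖β‖ ^ 2 + inner ℝ b (act (skw P) w) + m * ‖w‖ ^ 2 := by
  have h1 : |inner ℝ b (act (skw P) w)| ≤ ‖b‖ * ‖act (skw P) w‖ := abs_real_inner_le_norm _ _
  have h2 := norm_act_skw_sq_le P w
  -- Young's inequality with `4 · (1/8) · m = m / 2`, which matches the factor `1/2` gained from
  -- skewness. The price `1/8` lowers `1/2` to `3/8`.
  have h3 : ‖b‖ * ‖act (skw P) w‖ ≤ 1 / 8 * frob P ^ 2 + m * ‖w‖ ^ 2 := by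
    have hm : 0 ≤ m := (sq_nonneg _).trans hb
    refine abs_le_of_sq_le_sq' ?_ (by positivity) |>.2
    calc (‖b‖ * ‖act (skw P) w‖) ^ 2 = ‖b‖ ^ 2 * ‖act (skw P) w‖ ^ 2 := by ring
      _ ≤ m * (1 / 2 * frob P ^ 2 * ‖w‖ ^ 2) := by gcongr
      _ ≤ _ := by nlinarith [sq_nonneg (1 / 8 * frob P ^ 2 - m * ‖w‖ ^ 2)]
  have := neg_abs_le (inner ℝ b (act (skw P) w))
  linarith

/-- The pointwise estimate of the dissipation balance. -/
lemma dissipation_bound (P A' Q' : M3) (w z u' z' β v : E) {m ℓ : ℝ} (hm : 0 ≤ m)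
    (hℓ : ‖u'‖ * frob Q' + frob A' * ‖z'‖ + frob Q' + ‖z'‖ + ‖v‖ ^ 2 ≤ ℓ) :
    - inner ℝ z (z + act P v)
      + inner ℝ (act (skw Q') u' + act (skw A') z') (act (skw P) w)
      + inner ℝ β (act (skw Q') w + act (skw P) z') + m * (2 * inner ℝ w z)
    ≤ 3 / 2 * m ^ 2 * ‖w‖ ^ 2
      + ℓ * (3 / 4 * frob P ^ 2 + 3 / 4 * ‖w‖ ^ 2 + ‖β‖ ^ 2) := by
  have fP := frob_nonneg P
  have fQ := frob_nonneg Q'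
  have fA := frob_nonneg A'
  have nw := norm_nonneg w
  have nz := norm_nonneg z
  have nu := norm_nonneg u'
  have nz' := norm_nonneg z'
  have nβ := norm_nonneg β
  have nv := norm_nonneg v
  -- Apart from the `w` term, `G` is twice the coercive lower bound `⅜ |P|² + ½ |β|²`. Its weights
  -- are large enough for Young's inequality to put `|P||w|`, `|β||w|` and `|β||P|` below `G`.
  set G := 3 / 4 * frob P ^ 2 + 3 / 4 * ‖w‖ ^ 2 + ‖β‖ ^ 2 with hG
  have G0 : 0 ≤ G := by positivity
  have t1 : - inner ℝ z (z + act P v) ≤ - ‖z‖ ^ 2 + ‖z‖ * (frob P * ‖v‖) := by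
    rw [inner_add_right, real_inner_self_eq_norm_sq]
    have := neg_abs_le (inner ℝ z (act P v))
    have h := abs_real_inner_le_norm z (act P v)
    have := mul_le_mul_of_nonneg_left (norm_act_le P v) nz
    linarith
  have t2 : inner ℝ w z ≤ ‖w‖ * ‖z‖ := real_inner_le_norm _ _
  have t2' := mul_le_mul_of_nonneg_left t2 hm
  have t3 : inner ℝ (act (skw Q') u' + act (skw A') z') (act (skw P) w)
      ≤ (‖u'‖ * frob Q' + frob A' * ‖z'‖) * G := by
    refine (real_inner_le_norm _ _).trans ?_
    refine mul_le_mul ?_ ?_ (norm_nonneg _) (by positivity)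
    · refine (norm_add_le _ _).trans (add_le_add ?_ (norm_act_skw_le _ _))
      rw [mul_comm]; exact norm_act_skw_le _ _
    · refine (norm_act_skw_le _ _).trans ?_
      rw [hG]; nlinarith [sq_nonneg (frob P - ‖w‖), sq_nonneg (frob P), sq_nonneg ‖w‖]
  have t4 : inner ℝ β (act (skw Q') w + act (skw P) z') ≤ (frob Q' + ‖z'‖) * G := by
    rw [inner_add_right, add_mul]
    refine add_le_add ?_ ?_
    · refine (real_inner_le_norm _ _).trans ?_
      have h := mul_le_mul_of_nonneg_left (norm_act_skw_le Q' w) nβ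
      have h' : ‖β‖ * ‖w‖ ≤ G := by
        rw [hG]; nlinarith [sq_nonneg (‖β‖ - ‖w‖), sq_nonneg (frob P), sq_nonneg ‖w‖]
      nlinarith [mul_le_mul_of_nonneg_left h' fQ]
    · refine (real_inner_le_norm _ _).trans ?_
      have h := mul_le_mul_of_nonneg_left (norm_act_skw_le P z') nβ
      have h' : ‖β‖ * frob P ≤ G := by
        rw [hG]; nlinarith [sq_nonneg (‖β‖ - frob P), sq_nonneg (frob P), sq_nonneg ‖w‖]
      nlinarith [mul_le_mul_of_nonneg_left h' nz']
  -- With `p = |P||v|` and `q = m|w|`, completing the square in `‖z‖` leaves `(p/2 + q)²`, and `pq ≤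
  -- (p² + q²)/2` bounds it by `¾ p² + (3/2) q²`.
  have t5 : - ‖z‖ ^ 2 + ‖z‖ * (frob P * ‖v‖) + 2 * (m * (‖w‖ * ‖z‖))
      ≤ 3 / 2 * m ^ 2 * ‖w‖ ^ 2 + ‖v‖ ^ 2 * G := by
    have h0 : ‖v‖ ^ 2 * (3 / 4 * frob P ^ 2) ≤ ‖v‖ ^ 2 * G := by
      refine mul_le_mul_of_nonneg_left ?_ (sq_nonneg _)
      rw [hG]; nlinarith [sq_nonneg ‖w‖, sq_nonneg ‖β‖]
    refine le_trans ?_ (add_le_add_right h0 _)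
    nlinarith [sq_nonneg (‖z‖ - (frob P * ‖v‖) / 2 - m * ‖w‖),
      sq_nonneg (frob P * ‖v‖ - m * ‖w‖)]
  have t6 := mul_le_mul_of_nonneg_right hℓ G0
  linarith

/-! ### Divergence theorem without boundary regularity -/

/-- A function with bounded gradient which vanishes on the boundary is controlled by the distance
to the complement. -/
lemma norm_le_of_frontier_eq_zero {Ω : Set E} (hΩ : IsOpen Ω) {f : E → ℝ} {B : ℝ≥0}
    (hf : ContinuousOn f (closure Ω)) (hd : ∀ x ∈ Ω, DifferentiableAt ℝ f x)
    (hB : ∀ x ∈ Ω, ‖fderiv ℝ f x‖ ≤ B) (h0 : ∀ x ∈ frontier Ω, f x = 0)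
    {x z : E} (hx : x ∈ Ω) (hz : z ∉ Ω) : ‖f x‖ ≤ B * ‖z - x‖ := by
  set r : ℝ → E := fun s => x + s • (z - x) with hr
  have hrc : Continuous r := by fun_prop
  -- The infimum `σ` of `Z` is the first exit time of the segment from `x` to `z`: before it the
  -- path lies in `Ω`, at it the path is on the frontier, where `f = 0`. The mean value inequality
  -- is applied up to `σ ≤ 1`.
  set Z : Set ℝ := Icc 0 1 ∩ r ⁻¹' Ωᶜ with hZ
  have hZc : IsCompact Z := isCompact_Icc.inter_right (hΩ.isClosed_compl.preimage hrc)
  have hZn : Z.Nonempty := ⟨1, by simp, by simpa [hr] using hz⟩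
  have hmem := hZc.sInf_mem hZn
  set σ := sInf Z with hσ
  have hin : ∀ s ∈ Ico 0 σ, r s ∈ Ω := by
    intro s hs
    by_contra hcon
    have : s ∈ Z := ⟨⟨hs.1, hs.2.le.trans hmem.1.2⟩, hcon⟩
    exact absurd (csInf_le hZc.bddBelow this) (not_le.2 hs.2)
  have hσ0 : 0 < σ := by
    rcases hmem.1.1.lt_or_eq with h | h
    · exact h
    · have := hmem.2; rw [← h] at this; simp [hr, hx] at this
  have hcl : ∀ s ∈ Icc 0 σ, r s ∈ closure Ω := by
    intro s hs
    have h1 : s ∈ closure (Ico 0 σ) := by rwa [closure_Ico hσ0.ne]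
    exact closure_mono (image_subset_iff.2 hin) (image_closure_subset_closure_image hrc ⟨s, h1, rfl⟩)
  have hfr : f (r σ) = 0 :=
    h0 _ ⟨hcl σ ⟨hσ0.le, le_rfl⟩, by rw [hΩ.interior_eq]; exact hmem.2⟩
  have hrd : ∀ s, HasDerivAt r (z - x) s := fun s => by
    have h := ((hasDerivAt_id s).smul_const (z - x)).const_add x
    rw [one_smul] at h
    exact h
  have key := norm_image_sub_le_of_norm_deriv_right_le_segment (f := f ∘ r)
    (f' := fun s => fderiv ℝ f (r s) (z - x)) (C := B * ‖z - x‖) (a := 0) (b := σ)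
    (hf.comp hrc.continuousOn hcl)
    (fun s hs => ((hd _ (hin s hs)).hasFDerivAt.comp_hasDerivAt s (hrd s)).hasDerivWithinAt)
    (fun s hs => (ContinuousLinearMap.le_opNorm _ _).trans
      (mul_le_mul_of_nonneg_right (hB _ (hin s hs)) (norm_nonneg _))) σ ⟨hσ0.le, le_rfl⟩
  have e0 : r 0 = x := by simp [hr]
  simp only [Function.comp_apply, hfr, e0, zero_sub, norm_neg, sub_zero] at key
  refine key.trans ?_
  exact mul_le_of_le_one_right (by positivity) hmem.1.2

/-- The extension by zero of a function with bounded gradient which vanishes on the boundary is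
Lipschitz. -/
lemma lipschitzWith_indicator {Ω : Set E} (hΩ : IsOpen Ω) {f : E → ℝ} {B : ℝ≥0}
    (hf : ContinuousOn f (closure Ω)) (hd : ∀ x ∈ Ω, DifferentiableAt ℝ f x)
    (hB : ∀ x ∈ Ω, ‖fderiv ℝ f x‖ ≤ B) (h0 : ∀ x ∈ frontier Ω, f x = 0) :
    LipschitzWith B (Ω.indicator f) := by
  have key : ∀ {x z : E}, x ∈ Ω → z ∉ Ω → ‖f x‖ ≤ B * ‖z - x‖ := fun hx hz =>
    norm_le_of_frontier_eq_zero hΩ hf hd hB h0 hx hz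
  refine LipschitzWith.of_dist_le_mul fun x y => ?_
  rw [dist_eq_norm, dist_eq_norm]
  by_cases hx : x ∈ Ω <;> by_cases hy : y ∈ Ω
  · rw [indicator_of_mem hx, indicator_of_mem hy]
    by_cases hs : segment ℝ x y ⊆ Ω
    · exact (convex_segment x y).norm_image_sub_le_of_norm_fderiv_le (𝕜 := ℝ)
        (fun z hz => hd z (hs hz)) (fun z hz => hB z (hs hz)) (right_mem_segment ℝ x y)
        (left_mem_segment ℝ x y)
    -- If the segment leaves `Ω`, both values are compared with zero at one point `z` outside; since
    -- `z` lies on the segment, the two distances add up and the constant is not worsened.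
    · obtain ⟨z, hz, hzΩ⟩ := not_subset.1 hs
      have h1 := key hx hzΩ
      have h2 := key hy hzΩ
      have h3 := dist_add_dist_of_mem_segment hz
      rw [dist_eq_norm, dist_eq_norm, dist_eq_norm, ← norm_neg (x - z), neg_sub] at h3
      calc ‖f x - f y‖ ≤ ‖f x‖ + ‖f y‖ := norm_sub_le _ _
        _ ≤ B * (‖z - x‖ + ‖z - y‖) := by linarith
        _ = _ := by rw [h3]
  · rw [indicator_of_mem hx, indicator_of_notMem hy, sub_zero, norm_sub_rev]
    exact key hx hy
  · rw [indicator_of_notMem hx, indicator_of_mem hy, zero_sub, norm_neg]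
    exact key hy hx
  · rw [indicator_of_notMem hx, indicator_of_notMem hy, sub_zero, norm_zero]
    positivity

/-- The gradient of a function vanishes almost everywhere on its zero set. -/
lemma ae_fderiv_eq_zero_of_eq_zero {f : E → ℝ} {s : Set E} (hs : MeasurableSet s)
    (hf : ∀ x ∈ s, f x = 0) (hd : ∀ x ∈ s, DifferentiableAt ℝ f x) :
    ∀ᵐ x ∂volume.restrict s, fderiv ℝ f x = 0 := by
  set e : E := EuclideanSpace.single 0 1 with he
  -- On `s` the map `f • e` is approximated by the linear map `0` with error constant `0`, so its
  -- derivative is at distance at most `0` from `0` almost everywhere on `s`. The unit vector `e`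
  -- only turns `f` into a map from `E` to itself.
  have happ : ApproximatesLinearOn (fun x => f x • e) (0 : E →L[ℝ] E) s 0 := by
    refine fun x hx y hy => ?_
    simp [hf x hx, hf y hy]
  have := happ.norm_fderiv_sub_le volume hs (fun x => (fderiv ℝ f x).smulRight e)
    (fun x hx => ((hd x hx).hasFDerivAt.smul_const e).hasFDerivWithinAt)
  filter_upwards [this] with x hx
  have h0 : fderiv ℝ f x = 0 ∨ e = 0 := by simpa using hx
  exact h0.resolve_right (by simp [he])

/-- The divergence theorem on an arbitrary bounded open set, for functions with bounded gradient
which vanish on the boundary. -/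
lemma integral_fderiv_eq_zero {Ω : Set E} (hΩ : IsOpen Ω) (hΩb : Bornology.IsBounded Ω)
    {f : E → ℝ} {B : ℝ} (hf : ContinuousOn f (closure Ω)) (hd : ∀ x ∈ Ω, DifferentiableAt ℝ f x)
    (hB : ∀ x ∈ Ω, ‖fderiv ℝ f x‖ ≤ B) (h0 : ∀ x ∈ frontier Ω, f x = 0) (e : E) :
    ∫ x in Ω, fderiv ℝ f x e = 0 := by
  have hLip := lipschitzWith_indicator (B := B.toNNReal) hΩ hf hd
    (fun x hx => (hB x hx).trans (Real.le_coe_toNNReal B)) h0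
  have hcs : HasCompactSupport (Ω.indicator f) :=
    HasCompactSupport.intro hΩb.isCompact_closure fun x hx =>
      indicator_of_notMem (fun h => hx (subset_closure h)) f
  -- Integration by parts against the constant `1`; the direction `-e` makes the derivative in
  -- direction `e` fall on the extension.
  have h1 := (LipschitzWith.const (1 : ℝ)).integral_lineDeriv_mul_eq (μ := volume) hLip hcs (-e)
  have hc : ∀ x, lineDeriv ℝ (fun _ : E => (1 : ℝ)) x (-e) = 0 := fun x => by simp [lineDeriv]
  simp only [hc, zero_mul, integral_zero, neg_neg, mul_one] at h1
  rw [h1, ← integral_indicator hΩ.measurableSet]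
  refine integral_congr_ae ?_
  -- The frontier may have positive measure, so the gradient of the extension has to be shown to
  -- vanish almost everywhere on the whole complement of `Ω`.
  have hs : MeasurableSet (Ωᶜ ∩ {x | DifferentiableAt ℝ (Ω.indicator f) x}) :=
    hΩ.measurableSet.compl.inter (measurableSet_of_differentiableAt ℝ _)
  have hz := ae_fderiv_eq_zero_of_eq_zero (f := Ω.indicator f) hs
    (fun x hx => indicator_of_notMem hx.1 f) (fun x hx => hx.2)
  rw [ae_restrict_iff' hs] at hz
  filter_upwards [hz, hLip.ae_differentiableAt (μ := volume)] with x hx hdx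
  rw [hdx.lineDeriv_eq_fderiv]
  by_cases hxΩ : x ∈ Ω
  · rw [indicator_of_mem hxΩ]
    have : Ω.indicator f =ᶠ[𝓝 x] f := by
      filter_upwards [hΩ.mem_nhds hxΩ] with y hy using indicator_of_mem hy f
    rw [this.fderiv_eq]
  · rw [indicator_of_notMem hxΩ, hx ⟨hxΩ, hdx⟩]; rfl

/-! ### Gradients inside the domain and the Poincaré inequality -/

lemma integrableOn_of_continuousOn_closure {Ω : Set E} (hΩb : Bornology.IsBounded Ω) {f : E → ℝ}
    (hf : ContinuousOn f (closure Ω)) : IntegrableOn f Ω :=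
  (hf.integrableOn_compact hΩb.isCompact_closure).mono_set subset_closure

lemma fderivWithin_closure {F : Type*} [NormedAddCommGroup F] [NormedSpace ℝ F] {Ω : Set E}
    (hΩ : IsOpen Ω) (u : E → F) {x : E} (hx : x ∈ Ω) :
    fderivWithin ℝ u (closure Ω) x = fderiv ℝ u x :=
  fderivWithin_of_mem_nhds (mem_of_superset (hΩ.mem_nhds hx) subset_closure)

lemma grad_apply {Ω : Set E} (hΩ : IsOpen Ω) (u : E → E) {x : E} (hx : x ∈ Ω) (i j : Fin 3) :
    grad Ω u x i j = (fderiv ℝ u x (EuclideanSpace.single j 1)) i := by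
  simp [grad, fderivWithin_closure hΩ u hx]

/-- The `i`-th coordinate as a continuous linear functional. -/
abbrev coord (i : Fin 3) : E →L[ℝ] ℝ := EuclideanSpace.proj i

lemma fderiv_coord {u : E → E} {x : E} (hu : DifferentiableAt ℝ u x) (i : Fin 3) (e : E) :
    fderiv ℝ (fun y => u y i) x e = (fderiv ℝ u x e) i := by
  have h := ((coord i).hasFDerivAt.comp x hu.hasFDerivAt)
  have h' : HasFDerivAt (fun y => u y i) _ x := h
  rw [h'.fderiv]; rfl

/-- The integral of `∂₀(x₀ |w|²) = |w|² + 2 x₀ ⟨w, ∂₀w⟩` over `Ω` vanishes. With `|x₀| ≤ R` and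
Young's inequality this yields the constant `4R²`. -/
lemma exists_isPoincareConstant {Ω : Set E} (hΩ : IsOpen Ω) (hΩb : Bornology.IsBounded Ω) :
    ∃ c : ℝ, IsPoincareConstant Ω c := by
  obtain ⟨R, hR0, hR⟩ : ∃ R : ℝ, 0 < R ∧ ∀ x ∈ closure Ω, ‖x‖ ≤ R := by
    obtain ⟨R, hR⟩ := hΩb.closure.exists_norm_le
    exact ⟨max R 1, by positivity, fun x hx => (hR x hx).trans (le_max_left _ _)⟩
  refine ⟨4 * R ^ 2, by positivity, fun w hwc hwd ⟨B, hB⟩ hw0 => ?_⟩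
  have hwdiff : ∀ x ∈ Ω, DifferentiableAt ℝ w x := fun x hx =>
    (hwd.differentiableOn (by norm_num)).differentiableAt (hΩ.mem_nhds hx)
  obtain ⟨N, hN⟩ : ∃ N, ∀ x ∈ closure Ω, ‖w x‖ ≤ N :=
    hΩb.isCompact_closure.exists_bound_of_continuousOn hwc
  set e : E := EuclideanSpace.single 0 1 with he
  have he1 : ‖e‖ = 1 := by simp [he]
  set f : E → ℝ := fun x => x 0 * ‖w x‖ ^ 2 with hf
  have hx0 : ∀ x : E, HasFDerivAt (fun x : E => x 0) (coord 0) x := fun x =>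
    (coord 0).hasFDerivAt
  have hfd : ∀ x ∈ Ω, HasFDerivAt f (x 0 • (2 • (innerSL ℝ (w x)).comp (fderiv ℝ w x))
      + ‖w x‖ ^ 2 • coord 0) x := fun x hx =>
    (hx0 x).mul (hwdiff x hx).hasFDerivAt.norm_sq
  have hcoord : ∀ (x : E), ‖x 0‖ ≤ ‖x‖ := fun x => PiLp.norm_apply_le x 0
  have hfe : ∀ x ∈ Ω, fderiv ℝ f x e = x 0 * (2 * inner ℝ (w x) (fderiv ℝ w x e)) + ‖w x‖ ^ 2 := by
    intro x hx
    rw [(hfd x hx).fderiv]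
    simp [he, two_mul]
  have hbound : ∀ x ∈ Ω, ‖fderiv ℝ f x‖ ≤ R * (2 * (N * B)) + N ^ 2 := by
    intro x hx
    have hN' := hN x (subset_closure hx)
    have hN0 : 0 ≤ N := (norm_nonneg _).trans hN'
    rw [(hfd x hx).fderiv]
    refine ContinuousLinearMap.opNorm_le_bound _ (by
      have : 0 ≤ B := (norm_nonneg _).trans (hB x hx)
      positivity) fun y => ?_
    simp only [add_apply, smul_apply,
      ContinuousLinearMap.comp_apply, innerSL_apply_apply, smul_eq_mul,
      nsmul_eq_mul, Nat.cast_ofNat]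
    refine (norm_add_le _ _).trans ?_
    rw [add_mul]
    refine add_le_add ?_ ?_
    · rw [norm_mul, norm_mul, Real.norm_ofNat, mul_assoc, mul_assoc, mul_assoc]
      have h1 : ‖inner ℝ (w x) (fderiv ℝ w x y)‖ ≤ N * (B * ‖y‖) :=
        (norm_inner_le_norm _ _).trans (mul_le_mul hN' (((fderiv ℝ w x).le_opNorm y).trans
          (mul_le_mul_of_nonneg_right (hB x hx) (norm_nonneg _))) (norm_nonneg _) hN0)
      have h2 := (hcoord x).trans (hR x (subset_closure hx))
      gcongr
    · rw [norm_mul]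
      have : ‖coord 0 y‖ ≤ ‖y‖ := hcoord y
      simp only [norm_pow, norm_norm]
      gcongr
  have hfc : ContinuousOn f (closure Ω) := by
    have : ContinuousOn (fun x : E => x 0) (closure Ω) := by fun_prop
    exact this.mul (hwc.norm.pow 2)
  have hint := integral_fderiv_eq_zero hΩ hΩb hfc (fun x hx => (hfd x hx).differentiableAt) hbound
    (fun x hx => by simp [hf, hw0 x hx]) e
  have hcol : ∀ x ∈ Ω, ‖fderiv ℝ w x e‖ ^ 2 ≤ frob (grad Ω w x) ^ 2 := by
    intro x hx
    rw [frob_sq, ddot, norm_sq_eq_sum]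
    refine Finset.sum_le_sum fun i _ => ?_
    rw [← Finset.add_sum_erase _ _ (Finset.mem_univ (0 : Fin 3)), grad_apply hΩ w hx, ← sq]
    exact le_add_of_nonneg_right (Finset.sum_nonneg fun j _ => mul_self_nonneg _)
  have hpt : ∀ x ∈ Ω, 1 / 2 * ‖w x‖ ^ 2 - 2 * R ^ 2 * frob (grad Ω w x) ^ 2 ≤ fderiv ℝ f x e := by
    intro x hx
    rw [hfe x hx]
    have h1 : |x 0 * inner ℝ (w x) (fderiv ℝ w x e)| ≤ R * (‖w x‖ * ‖fderiv ℝ w x e‖) := by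
      rw [abs_mul]
      exact mul_le_mul ((hcoord x).trans (hR x (subset_closure hx)))
        (abs_real_inner_le_norm _ _) (abs_nonneg _) hR0.le
    have h2 := neg_abs_le (x 0 * inner ℝ (w x) (fderiv ℝ w x e))
    have h3 := mul_le_mul_of_nonneg_left (hcol x hx) (by positivity : 0 ≤ 2 * R ^ 2)
    -- The square gives `2R |w||∂₀w| ≤ ½ |w|² + 2R² |∂₀w|²`.
    nlinarith [sq_nonneg (‖w x‖ - 2 * R * ‖fderiv ℝ w x e‖)]
  have hfdc : ContinuousOn (fderiv ℝ w) Ω := hwd.continuousOn_fderiv_of_isOpen hΩ (by norm_num)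
  have : IsFiniteMeasure (volume.restrict Ω) := isFiniteMeasure_restrict.2 hΩb.measure_lt_top.ne
  have hgi : IntegrableOn (fun x => frob (grad Ω w x) ^ 2) Ω := by
    have hgc : ContinuousOn (fun x => frob (grad Ω w x) ^ 2) Ω := by
      refine (continuous_frob.comp_continuousOn ?_).pow 2
      refine continuousOn_pi.2 fun i => continuousOn_pi.2 fun j => ?_
      refine ContinuousOn.congr (f := fun x => (fderiv ℝ w x (EuclideanSpace.single j 1)) i) ?_
        fun x hx => grad_apply hΩ w hx i j
      fun_prop
    refine Integrable.of_bound (hgc.aestronglyMeasurable hΩ.measurableSet) (9 * B ^ 2) ?_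
    refine (ae_restrict_iff' hΩ.measurableSet).2 (ae_of_all _ fun x hx => ?_)
    rw [Real.norm_of_nonneg (sq_nonneg _), frob_sq, ddot]
    have hij : ∀ i j, grad Ω w x i j * grad Ω w x i j ≤ B ^ 2 := by
      intro i j
      have h1 : |grad Ω w x i j| ≤ B := by
        rw [grad_apply hΩ w hx, ← Real.norm_eq_abs]
        refine (PiLp.norm_apply_le _ i).trans ?_
        refine ((fderiv ℝ w x).le_opNorm _).trans ?_
        simpa using hB x hx
      rw [← sq, ← sq_abs]
      exact pow_le_pow_left₀ (abs_nonneg _) h1 2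
    refine (Finset.sum_le_sum fun i _ => Finset.sum_le_sum fun j _ => hij i j).trans ?_
    simp; ring_nf; rfl
  have hwi : IntegrableOn (fun x => ‖w x‖ ^ 2) Ω :=
    integrableOn_of_continuousOn_closure hΩb (hwc.norm.pow 2)
  have hfi : IntegrableOn (fun x => fderiv ℝ f x e) Ω := by
    refine Integrable.of_bound ?_ (R * (2 * (N * B)) + N ^ 2) ?_
    · exact (measurable_fderiv_apply_const ℝ f e).aestronglyMeasurable
    · refine (ae_restrict_iff' hΩ.measurableSet).2 (ae_of_all _ fun x hx => ?_)
      exact ((fderiv ℝ f x).le_opNorm e).trans (by rw [he1, mul_one]; exact hbound x hx)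
  have hmono := setIntegral_mono_on ((hwi.const_mul (1 / 2)).sub (hgi.const_mul (2 * R ^ 2))) hfi
    hΩ.measurableSet hpt
  rw [hint] at hmono
  simp only [Pi.sub_apply] at hmono
  rw [integral_sub (hwi.const_mul (1 / 2)) (hgi.const_mul (2 * R ^ 2)), integral_const_mul,
    integral_const_mul] at hmono
  linarith

/-! ### Regular fields: slices and mixed derivatives -/

section Slices

variable {V : Type*} [TopologicalSpace V] {Ω : Set E} {T : ℝ} {f : ℝ × E → V}

lemma continuousOn_slice_space (hf : ContinuousOn f (Icc 0 T ×ˢ closure Ω)) {t : ℝ}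
    (ht : t ∈ Icc 0 T) : ContinuousOn (fun x => f (t, x)) (closure Ω) :=
  hf.comp (by fun_prop) fun _ hx => ⟨ht, hx⟩

lemma continuousOn_slice_time (hf : ContinuousOn f (Icc 0 T ×ˢ closure Ω)) {x : E}
    (hx : x ∈ closure Ω) : ContinuousOn (fun t => f (t, x)) (Icc 0 T) :=
  hf.comp (by fun_prop) fun _ ht => ⟨ht, hx⟩

end Slices

lemma isCompact_cylinder {Ω : Set E} (hΩb : Bornology.IsBounded Ω) (T : ℝ) :
    IsCompact (Icc 0 T ×ˢ closure Ω) :=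
  isCompact_Icc.prod hΩb.isCompact_closure

section Regular

variable {Ω : Set E} {T : ℝ} {d : ℝ → E → E}

lemma continuousOn_matrix_of_fderivWithin {X : Type*} [TopologicalSpace X] {K : Set X}
    {L : X → E →L[ℝ] E} (hL : ContinuousOn L K) :
    ContinuousOn (fun q => (Matrix.of fun i j => (L q (EuclideanSpace.single j 1)) i : M3)) K := by
  refine continuousOn_pi.2 fun i => continuousOn_pi.2 fun j => ?_
  simp only [Matrix.of_apply]
  fun_prop

lemma IsRegular.continuousOn_grad (h : IsRegular Ω T d) :
    ContinuousOn (fun q : ℝ × E => grad Ω (d q.1) q.2) (Icc 0 T ×ˢ closure Ω) :=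
  continuousOn_matrix_of_fderivWithin h.cont_grad

lemma IsRegular.continuousOn_grad_dt (h : IsRegular Ω T d) :
    ContinuousOn (fun q : ℝ × E => grad Ω (dt T d q.1) q.2) (Icc 0 T ×ˢ closure Ω) :=
  continuousOn_matrix_of_fderivWithin h.cont_grad_dt

lemma IsRegular.continuousOn_bend (h : IsRegular Ω T d) :
    ContinuousOn (fun q : ℝ × E => bend Ω (d q.1) q.2) (Icc 0 T ×ˢ closure Ω) :=
  continuous_act.comp_continuousOn
    ((continuous_skw.comp_continuousOn h.continuousOn_grad).prodMk h.cont)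

lemma IsRegular.hasDerivAt (h : IsRegular Ω T d) {t : ℝ} (ht : t ∈ Ioo 0 T) {x : E}
    (hx : x ∈ closure Ω) : HasDerivAt (fun s => d s x) (dt T d t x) t :=
  ((h.diff_time x hx t (Ioo_subset_Icc_self ht)).hasDerivWithinAt).hasDerivAt
    (Icc_mem_nhds ht.1 ht.2)

lemma IsRegular.differentiableAt_dt (hΩ : IsOpen Ω) (h : IsRegular Ω T d) {t : ℝ}
    (ht : t ∈ Icc 0 T) {x : E} (hx : x ∈ Ω) : DifferentiableAt ℝ (dt T d t) x :=
  (h.diff_dt t ht).differentiableAt (mem_of_superset (hΩ.mem_nhds hx) subset_closure)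

lemma IsRegular.differentiableAt (hΩ : IsOpen Ω) (h : IsRegular Ω T d) {t : ℝ}
    (ht : t ∈ Icc 0 T) {x : E} (hx : x ∈ Ω) : DifferentiableAt ℝ (d t) x :=
  (h.diff_space t ht).differentiableAt (mem_of_superset (hΩ.mem_nhds hx) subset_closure)

lemma IsRegular.eq_add_integral (h : IsRegular Ω T d) {t : ℝ} (ht : t ∈ Icc 0 T) {x : E}
    (hx : x ∈ closure Ω) : d t x = d 0 x + ∫ s in (0 : ℝ)..t, dt T d s x := by
  have hsub : Icc 0 t ⊆ Icc 0 T := Icc_subset_Icc_right ht.2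
  rw [intervalIntegral.integral_eq_sub_of_hasDerivAt_of_le (f := fun s => d s x) ht.1
    ((continuousOn_slice_time h.cont hx).mono hsub)
    (fun s hs => h.hasDerivAt ⟨hs.1, hs.2.trans_le ht.2⟩ hx)
    (((continuousOn_slice_time h.cont_dt hx).mono hsub).intervalIntegrable_of_Icc ht.1)]
  abel

/-- The space and time derivatives commute, in integrated form. -/
lemma IsRegular.fderiv_eq_add_integral (hΩ : IsOpen Ω) (hΩb : Bornology.IsBounded Ω)
    (h : IsRegular Ω T d) {t : ℝ} (ht : t ∈ Icc 0 T) {x : E} (hx : x ∈ Ω) :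
    fderiv ℝ (d t) x = fderiv ℝ (d 0) x
      + ∫ s in (0 : ℝ)..t, fderivWithin ℝ (dt T d s) (closure Ω) x := by
  have hsub : Icc 0 t ⊆ Icc 0 T := Icc_subset_Icc_right ht.2
  have h0 : (0 : ℝ) ∈ Icc 0 T := ⟨le_rfl, ht.1.trans ht.2⟩
  obtain ⟨C, hC⟩ := (isCompact_cylinder hΩb T).exists_bound_of_continuousOn h.cont_grad_dt
  have hIoc : uIoc 0 t ⊆ Icc 0 T := by
    rw [uIoc_of_le ht.1]; exact Ioc_subset_Icc_self.trans hsub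
  have hii : ∀ y ∈ Ω, IntervalIntegrable (fun s => dt T d s y) volume 0 t := fun y hy =>
    ((continuousOn_slice_time h.cont_dt (subset_closure hy)).mono hsub).intervalIntegrable_of_Icc
      ht.1
  have hii' : IntervalIntegrable (fun s => fderivWithin ℝ (dt T d s) (closure Ω) x) volume 0 t :=
    ((continuousOn_slice_time h.cont_grad_dt (subset_closure hx)).mono
      hsub).intervalIntegrable_of_Icc ht.1
  -- Differentiation in `x` under the time integral of `∂_t d`; the bound on `∇∂_t d` over the
  -- compact cylinder is the dominating constant.
  have key := intervalIntegral.hasFDerivAt_integral_of_dominated_of_fderiv_le (μ := volume)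
    (a := 0) (b := t) (bound := fun _ => C) (F := fun y s => dt T d s y)
    (F' := fun y s => fderivWithin ℝ (dt T d s) (closure Ω) y) (x₀ := x) (𝕜 := ℝ)
    (hΩ.mem_nhds hx)
    (by filter_upwards [hΩ.mem_nhds hx] with y hy using
      (intervalIntegrable_iff.1 (hii y hy)).aestronglyMeasurable)
    (hii x hx) (intervalIntegrable_iff.1 hii').aestronglyMeasurable
    (ae_of_all _ fun s hs y hy => hC (s, y) ⟨hIoc hs, subset_closure hy⟩)
    intervalIntegrable_const
    (ae_of_all _ fun s hs y hy => by
      rw [fderivWithin_closure hΩ _ hy]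
      exact (h.differentiableAt_dt hΩ (hIoc hs) hy).hasFDerivAt)
  have h1 := ((h.differentiableAt hΩ h0 hx).hasFDerivAt).add key
  refine HasFDerivAt.fderiv (h1.congr_of_eventuallyEq ?_)
  filter_upwards [hΩ.mem_nhds hx] with y hy using h.eq_add_integral ht (subset_closure hy)

/-- Regularity provides `∇∂_t d`, but not `∂_t ∇d`. The latter exists because `∇d(t)` is `∇d(0)`
plus the time integral of the continuous function `∇∂_t d`. -/
lemma IsRegular.hasDerivAt_grad (hΩ : IsOpen Ω) (hΩb : Bornology.IsBounded Ω)
    (h : IsRegular Ω T d) {t : ℝ} (ht : t ∈ Ioo 0 T) {x : E} (hx : x ∈ Ω) (i j : Fin 3) :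
    HasDerivAt (fun s => grad Ω (d s) x i j) (grad Ω (dt T d t) x i j) t := by
  have hc := continuousOn_slice_time h.cont_grad_dt (subset_closure hx)
  have hsub : Icc 0 t ⊆ Icc 0 T := Icc_subset_Icc_right ht.2.le
  have h1 : HasDerivAt (fun r => ∫ s in (0 : ℝ)..r, fderivWithin ℝ (dt T d s) (closure Ω) x)
      (fderivWithin ℝ (dt T d t) (closure Ω) x) t :=
    intervalIntegral.integral_hasDerivAt_right
      ((hc.mono hsub).intervalIntegrable_of_Icc ht.1.le)
      ((hc.mono Ioo_subset_Icc_self).stronglyMeasurableAtFilter isOpen_Ioo t ht)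
      (hc.continuousAt (Icc_mem_nhds ht.1 ht.2))
  have h2 : HasDerivAt (fun r => fderiv ℝ (d r) x) (fderivWithin ℝ (dt T d t) (closure Ω) x) t := by
    refine (h1.const_add (fderiv ℝ (d 0) x)).congr_of_eventuallyEq ?_
    filter_upwards [Icc_mem_nhds ht.1 ht.2] with r hr
      using h.fderiv_eq_add_integral hΩ hΩb hr hx
  have h3 := ((coord i).comp (ContinuousLinearMap.apply ℝ E
    (EuclideanSpace.single j (1 : ℝ)))).hasFDerivAt.comp_hasDerivAt t h2
  refine h3.congr_of_eventuallyEq (Eventually.of_forall fun s => ?_)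
  simp only [Function.comp_apply]
  exact grad_apply hΩ (d s) hx i j

end Regular

/-! ### Time derivatives of integrals and of the energy density -/

/-- Differentiation under the integral sign for a density which is regular up to the boundary. -/
lemma hasDerivAt_integral_cylinder {Ω : Set E} (hΩ : IsOpen Ω) (hΩb : Bornology.IsBounded Ω)
    {T : ℝ} {φ φ' : ℝ → E → ℝ}
    (hφ : ContinuousOn (fun q : ℝ × E => φ q.1 q.2) (Icc 0 T ×ˢ closure Ω))
    (hφ' : ContinuousOn (fun q : ℝ × E => φ' q.1 q.2) (Icc 0 T ×ˢ closure Ω))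
    (hd : ∀ t ∈ Ioo 0 T, ∀ x ∈ Ω, HasDerivAt (fun s => φ s x) (φ' t x) t)
    {t : ℝ} (ht : t ∈ Ioo 0 T) :
    HasDerivAt (fun s => ∫ x in Ω, φ s x) (∫ x in Ω, φ' t x) t := by
  have : IsFiniteMeasure (volume.restrict Ω) := isFiniteMeasure_restrict.2 hΩb.measure_lt_top.ne
  obtain ⟨C, hC⟩ := (isCompact_cylinder hΩb T).exists_bound_of_continuousOn hφ'
  have hI : ∀ s ∈ Ioo 0 T, s ∈ Icc 0 T := fun s hs => Ioo_subset_Icc_self hs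
  refine (hasDerivAt_integral_of_dominated_loc_of_deriv_le (bound := fun _ => C) (F' := φ')
    (Ioo_mem_nhds ht.1 ht.2) ?_ ?_ ?_ ?_ (integrable_const _) ?_).2
  · filter_upwards [Ioo_mem_nhds ht.1 ht.2] with s hs
    exact (integrableOn_of_continuousOn_closure hΩb
      (continuousOn_slice_space hφ (hI s hs))).aestronglyMeasurable
  · exact integrableOn_of_continuousOn_closure hΩb (continuousOn_slice_space hφ (hI t ht))
  · exact (integrableOn_of_continuousOn_closure hΩb
      (continuousOn_slice_space hφ' (hI t ht))).aestronglyMeasurable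
  · exact (ae_restrict_iff' hΩ.measurableSet).2 (ae_of_all _ fun x hx s hs =>
      hC (s, x) ⟨hI s hs, subset_closure hx⟩)
  · exact (ae_restrict_iff' hΩ.measurableSet).2 (ae_of_all _ fun x hx s hs => hd s hs x hx)

lemma continuousOn_integral_cylinder {Ω : Set E} (hΩ : IsOpen Ω) (hΩb : Bornology.IsBounded Ω)
    {T : ℝ} {φ : ℝ → E → ℝ}
    (hφ : ContinuousOn (fun q : ℝ × E => φ q.1 q.2) (Icc 0 T ×ˢ closure Ω)) :
    ContinuousOn (fun s => ∫ x in Ω, φ s x) (Icc 0 T) := by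
  have : IsFiniteMeasure (volume.restrict Ω) := isFiniteMeasure_restrict.2 hΩb.measure_lt_top.ne
  obtain ⟨C, hC⟩ := (isCompact_cylinder hΩb T).exists_bound_of_continuousOn hφ
  refine continuousOn_of_dominated (bound := fun _ => C) ?_ ?_ (integrable_const _) ?_
  · exact fun s hs => (integrableOn_of_continuousOn_closure hΩb
      (continuousOn_slice_space hφ hs)).aestronglyMeasurable
  · exact fun s hs => (ae_restrict_iff' hΩ.measurableSet).2 (ae_of_all _ fun x hx =>
      hC (s, x) ⟨hs, subset_closure hx⟩)
  · exact (ae_restrict_iff' hΩ.measurableSet).2 (ae_of_all _ fun x hx =>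
      continuousOn_slice_time hφ (subset_closure hx))

section Density

lemma hasDerivAt_euclidean {f : ℝ → E} {f' : E} {t : ℝ}
    (h : ∀ i, HasDerivAt (fun s => f s i) (f' i) t) : HasDerivAt f f' t := by
  have h1 : HasDerivAt (fun s => (f s).ofLp) f'.ofLp t := hasDerivAt_pi.2 h
  exact ((EuclideanSpace.equiv (Fin 3) ℝ).symm.toContinuousLinearMap.hasFDerivAt).comp_hasDerivAt
    t h1

variable {A A' : ℝ → M3} {Q Q' : M3} {u u' : ℝ → E} {z z' : E} {t : ℝ}

lemma hasDerivAt_act (hA : ∀ i j, HasDerivAt (fun s => A s i j) (Q i j) t)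
    (hu : HasDerivAt u z t) :
    HasDerivAt (fun s => act (A s) (u s)) (act Q (u t) + act (A t) z) t := by
  refine hasDerivAt_euclidean fun i => ?_
  have hui : ∀ j, HasDerivAt (fun s => u s j) (z j) t := fun j =>
    (coord j).hasFDerivAt.comp_hasDerivAt t hu
  have h := HasDerivAt.fun_sum (u := Finset.univ) fun j _ => (hA i j).mul (hui j)
  rw [PiLp.add_apply, act_apply, act_apply, ← Finset.sum_add_distrib]
  exact h

lemma hasDerivAt_skw (hA : ∀ i j, HasDerivAt (fun s => A s i j) (Q i j) t) (i j : Fin 3) :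
    HasDerivAt (fun s => skw (A s) i j) (skw Q i j) t := by
  simp only [skw_apply]
  exact ((hA i j).sub (hA j i)).const_mul _

lemma hasDerivAt_frob_sq (hA : ∀ i j, HasDerivAt (fun s => A s i j) (Q i j) t) :
    HasDerivAt (fun s => frob (A s) ^ 2) (2 * ddot (A t) Q) t := by
  have h := HasDerivAt.fun_sum (u := Finset.univ) fun i _ =>
    HasDerivAt.fun_sum (u := Finset.univ) fun j _ => (hA i j).mul (hA i j)
  simp only [frob_sq]
  refine h.congr_deriv ?_
  simp only [ddot, Finset.mul_sum]
  exact Finset.sum_congr rfl fun i _ => Finset.sum_congr rfl fun j _ => by ring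

/-- The density of the relative energy, corrected by lower order terms. -/
def density (m : ℝ) (A A' : M3) (u u' : E) : ℝ :=
  1 / 2 * frob (A - A') ^ 2 + 1 / 2 * ‖act (skw A) u - act (skw A') u'‖ ^ 2
    + inner ℝ (act (skw A') u') (act (skw (A - A')) (u - u')) + m * ‖u - u'‖ ^ 2

/-- The derivative of `density m` in the direction `(Q, Q', z, z')`. -/
def densityDeriv (m : ℝ) (A A' Q Q' : M3) (u u' z z' : E) : ℝ :=
  ddot (A - A') (Q - Q')
    + (inner ℝ (act (skw A) u - act (skw A') u')
        (act (skw Q) u + act (skw A) z - (act (skw Q') u' + act (skw A') z'))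
      + (inner ℝ (act (skw A') u')
          (act (skw Q - skw Q') (u - u') + act (skw A - skw A') (z - z'))))
    + inner ℝ (act (skw Q') u' + act (skw A') z') (act (skw (A - A')) (u - u'))
    + m * (2 * inner ℝ (u - u') (z - z'))

lemma hasDerivAt_density (m : ℝ) (hA : ∀ i j, HasDerivAt (fun s => A s i j) (Q i j) t)
    (hA' : ∀ i j, HasDerivAt (fun s => A' s i j) (Q' i j) t)
    (hu : HasDerivAt u z t) (hu' : HasDerivAt u' z' t) :
    HasDerivAt (fun s => density m (A s) (A' s) (u s) (u' s))
      (densityDeriv m (A t) (A' t) Q Q' (u t) (u' t) z z') t := by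
  have hP : ∀ i j, HasDerivAt (fun s => (A s - A' s) i j) ((Q - Q') i j) t := fun i j =>
    (hA i j).sub (hA' i j)
  have hb := hasDerivAt_act (hasDerivAt_skw hA) hu
  have hb' := hasDerivAt_act (hasDerivAt_skw hA') hu'
  have hw := hu.sub hu'
  have h := ((((hasDerivAt_frob_sq hP).const_mul (1 / 2)).add
    ((hb.sub hb').norm_sq.const_mul (1 / 2))).add
    (hb'.inner ℝ (hasDerivAt_act (hasDerivAt_skw hP) hw))).add (hw.norm_sq.const_mul m)
  refine h.congr_deriv ?_
  simp only [densityDeriv, Pi.sub_apply, skw_sub]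
  ring

lemma continuousOn_density_comp {X : Type*} [TopologicalSpace X] {K : Set X} (m : ℝ)
    {A A' : X → M3} {u u' : X → E} (hA : ContinuousOn A K) (hA' : ContinuousOn A' K)
    (hu : ContinuousOn u K) (hu' : ContinuousOn u' K) :
    ContinuousOn (fun q => density m (A q) (A' q) (u q) (u' q)) K := by
  have h : Continuous fun p : (M3 × M3) × E × E => density m p.1.1 p.1.2 p.2.1 p.2.2 := by
    unfold density
    fun_prop
  exact h.comp_continuousOn (f := fun q => ((A q, A' q), u q, u' q))
    ((hA.prodMk hA').prodMk (hu.prodMk hu'))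

lemma continuousOn_densityDeriv_comp {X : Type*} [TopologicalSpace X] {K : Set X} (m : ℝ)
    {A A' Q Q' : X → M3} {u u' z z' : X → E} (hA : ContinuousOn A K) (hA' : ContinuousOn A' K)
    (hQ : ContinuousOn Q K) (hQ' : ContinuousOn Q' K) (hu : ContinuousOn u K)
    (hu' : ContinuousOn u' K) (hz : ContinuousOn z K) (hz' : ContinuousOn z' K) :
    ContinuousOn (fun q => densityDeriv m (A q) (A' q) (Q q) (Q' q) (u q) (u' q) (z q) (z' q))
      K := by
  have h : Continuous fun p : ((M3 × M3) × M3 × M3) × (E × E) × E × E =>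
      densityDeriv m p.1.1.1 p.1.1.2 p.1.2.1 p.1.2.2 p.2.1.1 p.2.1.2 p.2.2.1 p.2.2.2 := by
    unfold densityDeriv
    fun_prop
  exact h.comp_continuousOn
    (f := fun q => (((A q, A' q), Q q, Q' q), (u q, u' q), z q, z' q))
    (((hA.prodMk hA').prodMk (hQ.prodMk hQ')).prodMk
    ((hu.prodMk hu').prodMk (hz.prodMk hz')))

end Density

/-! ### Integration by parts -/

/-- Scalar functions which are continuous up to the boundary and have a bounded gradient. -/
structure HasBoundedGradient (Ω : Set E) (f : E → ℝ) : Prop where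
  cont : ContinuousOn f (closure Ω)
  diff : ∀ x ∈ Ω, DifferentiableAt ℝ f x
  bound : ∃ B : ℝ, ∀ x ∈ Ω, ‖fderiv ℝ f x‖ ≤ B

namespace HasBoundedGradient

variable {Ω : Set E} {f g : E → ℝ}

lemma add (hf : HasBoundedGradient Ω f) (hg : HasBoundedGradient Ω g) :
    HasBoundedGradient Ω fun x => f x + g x := by
  obtain ⟨B, hB⟩ := hf.bound
  obtain ⟨C, hC⟩ := hg.bound
  refine ⟨hf.cont.add hg.cont, fun x hx => (hf.diff x hx).add (hg.diff x hx), B + C,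
    fun x hx => ?_⟩
  rw [fderiv_fun_add (hf.diff x hx) (hg.diff x hx)]
  exact (norm_add_le _ _).trans (add_le_add (hB x hx) (hC x hx))

lemma mul (hΩb : Bornology.IsBounded Ω) (hf : HasBoundedGradient Ω f)
    (hg : HasBoundedGradient Ω g) : HasBoundedGradient Ω fun x => f x * g x := by
  obtain ⟨B, hB⟩ := hf.bound
  obtain ⟨C, hC⟩ := hg.bound
  obtain ⟨M, hM⟩ := hΩb.isCompact_closure.exists_bound_of_continuousOn hf.cont
  obtain ⟨N, hN⟩ := hΩb.isCompact_closure.exists_bound_of_continuousOn hg.cont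
  refine ⟨hf.cont.mul hg.cont, fun x hx => (hf.diff x hx).mul (hg.diff x hx), M * C + N * B,
    fun x hx => ?_⟩
  rw [fderiv_fun_mul (hf.diff x hx) (hg.diff x hx)]
  refine (norm_add_le _ _).trans (add_le_add ?_ ?_)
  · rw [norm_smul]
    exact mul_le_mul (hM x (subset_closure hx)) (hC x hx) (norm_nonneg _)
      ((norm_nonneg _).trans (hM x (subset_closure hx)))
  · rw [norm_smul]
    exact mul_le_mul (hN x (subset_closure hx)) (hB x hx) (norm_nonneg _)
      ((norm_nonneg _).trans (hN x (subset_closure hx)))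

lemma const (a : ℝ) : HasBoundedGradient Ω fun _ => a :=
  ⟨continuousOn_const, fun _ _ => differentiableAt_const _, 0, fun x _ => by simp⟩

lemma sub (hΩb : Bornology.IsBounded Ω) (hf : HasBoundedGradient Ω f)
    (hg : HasBoundedGradient Ω g) : HasBoundedGradient Ω fun x => f x - g x := by
  have h := hf.add ((const (-1)).mul hΩb hg)
  simpa [sub_eq_add_neg] using h

lemma sum {ι : Type*} (s : Finset ι) {F : ι → E → ℝ} (hF : ∀ i, HasBoundedGradient Ω (F i)) :
    HasBoundedGradient Ω fun x => ∑ i ∈ s, F i x := by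
  classical
  induction s using Finset.induction_on with
  | empty => simpa using const 0
  | insert a s ha ih => simpa [Finset.sum_insert ha] using (hF a).add ih

lemma clm {V : Type*} [NormedAddCommGroup V] [NormedSpace ℝ V] {F : E → V}
    (hΩ : IsOpen Ω) (hΩb : Bornology.IsBounded Ω)
    (hF : DifferentiableOn ℝ F (closure Ω))
    (hF' : ContinuousOn (fderivWithin ℝ F (closure Ω)) (closure Ω)) (L : V →L[ℝ] ℝ) :
    HasBoundedGradient Ω fun x => L (F x) := by
  obtain ⟨B, hB⟩ := hΩb.isCompact_closure.exists_bound_of_continuousOn hF'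
  have hd : ∀ x ∈ Ω, DifferentiableAt ℝ F x := fun x hx =>
    hF.differentiableAt (mem_of_superset (hΩ.mem_nhds hx) subset_closure)
  refine ⟨L.continuous.comp_continuousOn hF.continuousOn,
    fun x hx => L.differentiableAt.comp x (hd x hx), ‖L‖ * B, fun x hx => ?_⟩
  have h : HasFDerivAt (fun x => L (F x)) (L.comp (fderiv ℝ F x)) x :=
    L.hasFDerivAt.comp x (hd x hx).hasFDerivAt
  rw [h.fderiv, ← fderivWithin_closure hΩ F hx]
  exact (L.opNorm_comp_le _).trans
    (mul_le_mul_of_nonneg_left (hB x (subset_closure hx)) (norm_nonneg _))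

lemma integrableOn_fderiv (hΩ : IsOpen Ω) (hΩb : Bornology.IsBounded Ω)
    (hf : HasBoundedGradient Ω f) (e : E) : IntegrableOn (fun x => fderiv ℝ f x e) Ω := by
  have : IsFiniteMeasure (volume.restrict Ω) := isFiniteMeasure_restrict.2 hΩb.measure_lt_top.ne
  obtain ⟨B, hB⟩ := hf.bound
  refine Integrable.of_bound (measurable_fderiv_apply_const ℝ f e).aestronglyMeasurable
    (B * ‖e‖) ((ae_restrict_iff' hΩ.measurableSet).2 (ae_of_all _ fun x hx => ?_))
  exact ((fderiv ℝ f x).le_opNorm e).trans (mul_le_mul_of_nonneg_right (hB x hx) (norm_nonneg _))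

end HasBoundedGradient

/-- Integration by parts of a matrix field against a vector field with zero boundary values. -/
lemma integral_ddot_grad {Ω : Set E} (hΩ : IsOpen Ω) (hΩb : Bornology.IsBounded Ω)
    {M : E → M3} {φ : E → E} (hM : ∀ i j, HasBoundedGradient Ω fun x => M x i j)
    (hφd : ∀ x ∈ Ω, DifferentiableAt ℝ φ x) (hφ : ∀ i, HasBoundedGradient Ω fun x => φ x i)
    (hφ0 : ∀ x ∈ frontier Ω, φ x = 0) :
    IntegrableOn (fun x => ddot (M x) (grad Ω φ x) + inner ℝ (φ x) (mdiv Ω M x)) Ω ∧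
      ∫ x in Ω, (ddot (M x) (grad Ω φ x) + inner ℝ (φ x) (mdiv Ω M x)) = 0 := by
  have hprod : ∀ i j, HasBoundedGradient Ω fun x => M x i j * φ x i := fun i j =>
    (hM i j).mul hΩb (hφ i)
  -- By the product rule the integrand is a sum of derivatives of `M_ij φ_i`. Only `φ` has to vanish
  -- on the frontier for each of these integrals to be zero.
  have hpt : ∀ x ∈ Ω, ddot (M x) (grad Ω φ x) + inner ℝ (φ x) (mdiv Ω M x) =
      ∑ i, ∑ j, fderiv ℝ (fun y => M y i j * φ y i) x (EuclideanSpace.single j 1) := by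
    intro x hx
    rw [ddot, inner_eq_sum, ← Finset.sum_add_distrib]
    refine Finset.sum_congr rfl fun i _ => ?_
    have hm : (mdiv Ω M x) i =
        ∑ j, fderiv ℝ (fun y => M y i j) x (EuclideanSpace.single j 1) := by
      simp only [mdiv, fderivWithin_closure hΩ _ hx]
    rw [hm, Finset.mul_sum, ← Finset.sum_add_distrib]
    refine Finset.sum_congr rfl fun j _ => ?_
    rw [fderiv_fun_mul ((hM i j).diff x hx) ((hφ i).diff x hx), grad_apply hΩ φ hx]
    simp only [add_apply, smul_apply, smul_eq_mul, fderiv_coord (hφd x hx)]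
  have hint : ∀ i j, IntegrableOn (fun x => fderiv ℝ (fun y => M y i j * φ y i) x
      (EuclideanSpace.single j 1)) Ω := fun i j => (hprod i j).integrableOn_fderiv hΩ hΩb _
  refine ⟨IntegrableOn.congr_fun (f := fun x => ∑ i, ∑ j,
    fderiv ℝ (fun y => M y i j * φ y i) x (EuclideanSpace.single j 1)) ?_
    (fun x hx => (hpt x hx).symm) hΩ.measurableSet, ?_⟩
  · exact integrable_finsetSum _ fun i _ => integrable_finsetSum _ fun j _ => hint i j
  · rw [setIntegral_congr_fun hΩ.measurableSet hpt,
      integral_finsetSum _ fun i _ => integrable_finsetSum _ fun j _ => hint i j]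
    refine Finset.sum_eq_zero fun i _ => ?_
    rw [integral_finsetSum _ fun j _ => hint i j]
    refine Finset.sum_eq_zero fun j _ => ?_
    obtain ⟨B, hB⟩ := (hprod i j).bound
    exact integral_fderiv_eq_zero hΩ hΩb (hprod i j).cont (hprod i j).diff hB
      (fun x hx => by simp [hφ0 x hx]) _

/-! ### Weak form of the equation -/

section Weak

variable {Ω : Set E} {T : ℝ} {v g : E → E} {d : ℝ → E → E}

lemma IsRegular.hasBoundedGradient_coord (hΩ : IsOpen Ω) (hΩb : Bornology.IsBounded Ω)
    (h : IsRegular Ω T d) {t : ℝ} (ht : t ∈ Icc 0 T) (i : Fin 3) :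
    HasBoundedGradient Ω fun x => d t x i :=
  HasBoundedGradient.clm hΩ hΩb (h.diff_space t ht)
    (continuousOn_slice_space h.cont_grad ht) (coord i)

lemma IsRegular.hasBoundedGradient_dt_coord (hΩ : IsOpen Ω) (hΩb : Bornology.IsBounded Ω)
    (h : IsRegular Ω T d) {t : ℝ} (ht : t ∈ Icc 0 T) (i : Fin 3) :
    HasBoundedGradient Ω fun x => dt T d t x i :=
  HasBoundedGradient.clm hΩ hΩb (h.diff_dt t ht)
    (continuousOn_slice_space h.cont_grad_dt ht) (coord i)

lemma IsRegular.hasBoundedGradient_grad (hΩ : IsOpen Ω) (hΩb : Bornology.IsBounded Ω)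
    (h : IsRegular Ω T d) {t : ℝ} (ht : t ∈ Icc 0 T) (i j : Fin 3) :
    HasBoundedGradient Ω fun x => grad Ω (d t) x i j :=
  HasBoundedGradient.clm hΩ hΩb (h.diff_grad t ht) (continuousOn_slice_space h.cont_hess ht)
    ((coord i).comp (ContinuousLinearMap.apply ℝ E (EuclideanSpace.single j (1 : ℝ))))

/-- The entries are polynomials in `d` and `∇d`, and functions with bounded gradient form an algebra
on a bounded domain. -/
lemma IsRegular.hasBoundedGradient_skw_dyad (hΩ : IsOpen Ω) (hΩb : Bornology.IsBounded Ω)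
    (h : IsRegular Ω T d) {t : ℝ} (ht : t ∈ Icc 0 T) (i j : Fin 3) :
    HasBoundedGradient Ω fun x => skw (dyad (bend Ω (d t) x) (d t x)) i j := by
  have hu := h.hasBoundedGradient_coord hΩ hΩb ht
  have hA := h.hasBoundedGradient_grad hΩ hΩb ht
  have hb : ∀ k, HasBoundedGradient Ω fun x => bend Ω (d t) x k := fun k => by
    simp only [bend, act_apply, skw_apply]
    exact HasBoundedGradient.sum _ fun l =>
      ((HasBoundedGradient.const (1 / 2)).mul hΩb ((hA k l).sub hΩb (hA l k))).mul hΩb (hu l)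
  simp only [skw_apply, dyad, Matrix.vecMulVec_apply]
  exact (HasBoundedGradient.const (1 / 2)).mul hΩb
    (((hb i).mul hΩb (hu j)).sub hΩb ((hb j).mul hΩb (hu i)))

/-- The weak form of the equation. -/
lemma IsSolution.weak_form (hΩ : IsOpen Ω) (hΩb : Bornology.IsBounded Ω)
    (h : IsSolution Ω T v g d) {t : ℝ} (ht : t ∈ Ioo 0 T) {φ : E → E}
    (hφd : ∀ x ∈ Ω, DifferentiableAt ℝ φ x) (hφ : ∀ i, HasBoundedGradient Ω fun x => φ x i)
    (hφ0 : ∀ x ∈ frontier Ω, φ x = 0) :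
    let W : E → ℝ := fun x =>
      ddot (grad Ω (d t) x + skw (dyad (bend Ω (d t) x) (d t x))) (grad Ω φ x)
        + inner ℝ (φ x) (act (skw (grad Ω (d t) x))ᵀ (bend Ω (d t) x))
        + inner ℝ (φ x) (dt T d t x + act (grad Ω (d t) x) (v x))
    IntegrableOn W Ω ∧ ∫ x in Ω, W x = 0 := by
  intro W
  have htI := Ioo_subset_Icc_self ht
  obtain ⟨i1, e1⟩ := integral_ddot_grad hΩ hΩb
    (h.regular.hasBoundedGradient_grad hΩ hΩb htI) hφd hφ hφ0
  obtain ⟨i2, e2⟩ := integral_ddot_grad hΩ hΩb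
    (h.regular.hasBoundedGradient_skw_dyad hΩ hΩb htI) hφd hφ hφ0
  have hW : ∀ x ∈ Ω, W x =
      (ddot (grad Ω (d t) x) (grad Ω φ x) + inner ℝ (φ x) (mdiv Ω (grad Ω (d t)) x))
      + (ddot (skw (dyad (bend Ω (d t) x) (d t x))) (grad Ω φ x)
        + inner ℝ (φ x) (mdiv Ω (fun y => skw (dyad (bend Ω (d t) y) (d t y))) x)) := by
    intro x hx
    simp only [W]
    -- The equation replaces `∂_t d + (∇d) v` by `-δF/δd`; its zeroth-order part cancels, and two
    -- divergences paired with `φ` remain.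
    rw [h.equation t ht x hx]
    simp only [varDeriv, ddot_add_left, inner_neg_right, inner_add_right, inner_sub_right]
    ring
  refine ⟨(i1.add i2).congr_fun (fun x hx => (hW x hx).symm) hΩ.measurableSet, ?_⟩
  rw [setIntegral_congr_fun hΩ.measurableSet hW, integral_add i1 i2, e1, e2, add_zero]

/-- The boundary values do not depend on time. This makes `∂_t(d - d')` an admissible test function.
-/
lemma IsSolution.dt_eq_zero (h : IsSolution Ω T v g d) {t : ℝ} (ht : t ∈ Icc 0 T) {x : E}
    (hx : x ∈ frontier Ω) : dt T d t x = 0 := by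
  rw [dt, derivWithin_congr (f := fun _ => g x) (fun s hs => h.boundary s hs x hx)
    (h.boundary t ht x hx)]
  simp

end Weak

/-! ### Maxima over compact sets -/

lemma le_maxOver {α : Type*} [TopologicalSpace α] {S : Set α} (hS : IsCompact S) {f : α → ℝ}
    (hf : ContinuousOn f S) {x : α} (hx : x ∈ S) : f x ≤ maxOver S f :=
  le_csSup (hS.bddAbove_image hf) (mem_image_of_mem f hx)

lemma maxOver_nonneg {α : Type*} {S : Set α} {f : α → ℝ} (hf : ∀ x ∈ S, 0 ≤ f x) :
    0 ≤ maxOver S f :=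
  Real.sSup_nonneg (by rintro _ ⟨x, hx, rfl⟩; exact hf x hx)

/-- Connects the weight `m = max |b'|²` of the correction, which enters the rate as `m²`, with the
fourth power in `exponent`. -/
lemma maxOver_sq_le {α : Type*} [TopologicalSpace α] {S : Set α} (hS : IsCompact S) {f : α → ℝ}
    (hf : ContinuousOn f S) : maxOver S (fun x => f x ^ 2) ^ 2 ≤ maxOver S fun x => f x ^ 4 := by
  rcases S.eq_empty_or_nonempty with rfl | hne
  · simp [maxOver]
  · obtain ⟨x, hx, hmax⟩ := hS.exists_sSup_image_eq hne (hf.pow 2)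
    have hmax' : maxOver S (fun x => f x ^ 2) = f x ^ 2 := hmax
    rw [hmax']
    calc (f x ^ 2) ^ 2 = f x ^ 4 := by ring
      _ ≤ _ := le_maxOver hS (hf.pow 4) hx

lemma continuousOn_maxOver {Ω : Set E} (hΩb : Bornology.IsBounded Ω) {T : ℝ} {f : ℝ → E → ℝ}
    (hf : ContinuousOn (fun q : ℝ × E => f q.1 q.2) (Icc 0 T ×ˢ closure Ω)) :
    ContinuousOn (fun s => maxOver (closure Ω) (f s)) (Icc 0 T) := by
  rw [continuousOn_iff_continuous_domRestrict]
  have : CompactSpace (closure Ω) := isCompact_iff_compactSpace.1 hΩb.isCompact_closure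
  have h : Continuous (Function.HasUncurry.uncurry
      fun (s : Icc (0 : ℝ) T) (x : closure Ω) => f s x) :=
    hf.comp_continuous (f := fun p : Icc (0 : ℝ) T × closure Ω => ((p.1 : ℝ), (p.2 : E)))
      (by fun_prop) fun p => ⟨p.1.2, p.2.2⟩
  convert isCompact_univ.continuous_sSup h using 2 with s
  simp only [Set.domRestrict_apply, maxOver]
  congr 1
  ext y
  simp

/-! ### Estimates for the corrected energy -/

/-- The relative energy, corrected by lower order terms. -/
def correctedEnergy (Ω : Set E) (m : ℝ) (u u' : E → E) : ℝ :=
  ∫ x in Ω, density m (grad Ω u x) (grad Ω u' x) (u x) (u' x)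

section Energy

variable {Ω : Set E} {T : ℝ} {v g : E → E} {d d' : ℝ → E → E}

lemma continuousOn_density (m : ℝ) (h : IsRegular Ω T d) (h' : IsRegular Ω T d') :
    ContinuousOn (fun q : ℝ × E => density m (grad Ω (d q.1) q.2) (grad Ω (d' q.1) q.2)
      (d q.1 q.2) (d' q.1 q.2)) (Icc 0 T ×ˢ closure Ω) :=
  continuousOn_density_comp m h.continuousOn_grad h'.continuousOn_grad h.cont h'.cont

lemma continuousOn_densityDeriv (m : ℝ) (h : IsRegular Ω T d) (h' : IsRegular Ω T d') :
    ContinuousOn (fun q : ℝ × E => densityDeriv m (grad Ω (d q.1) q.2) (grad Ω (d' q.1) q.2)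
      (grad Ω (dt T d q.1) q.2) (grad Ω (dt T d' q.1) q.2)
      (d q.1 q.2) (d' q.1 q.2) (dt T d q.1 q.2) (dt T d' q.1 q.2)) (Icc 0 T ×ˢ closure Ω) :=
  continuousOn_densityDeriv_comp m h.continuousOn_grad h'.continuousOn_grad h.continuousOn_grad_dt
    h'.continuousOn_grad_dt h.cont h'.cont h.cont_dt h'.cont_dt

lemma hasDerivAt_correctedEnergy (hΩ : IsOpen Ω) (hΩb : Bornology.IsBounded Ω) (m : ℝ)
    (h : IsRegular Ω T d) (h' : IsRegular Ω T d') {t : ℝ} (ht : t ∈ Ioo 0 T) :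
    HasDerivAt (fun s => correctedEnergy Ω m (d s) (d' s))
      (∫ x in Ω, densityDeriv m (grad Ω (d t) x) (grad Ω (d' t) x) (grad Ω (dt T d t) x)
        (grad Ω (dt T d' t) x) (d t x) (d' t x) (dt T d t x) (dt T d' t x)) t :=
  hasDerivAt_integral_cylinder hΩ hΩb (continuousOn_density m h h')
    (continuousOn_densityDeriv m h h')
    (fun _ hs _ hx => hasDerivAt_density m (h.hasDerivAt_grad hΩ hΩb hs hx)
      (h'.hasDerivAt_grad hΩ hΩb hs hx) (h.hasDerivAt hs (subset_closure hx))
      (h'.hasDerivAt hs (subset_closure hx))) ht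

lemma integrableOn_slice (hΩb : Bornology.IsBounded Ω) {f : ℝ × E → ℝ}
    (hf : ContinuousOn f (Icc 0 T ×ˢ closure Ω)) {t : ℝ} (ht : t ∈ Icc 0 T) :
    IntegrableOn (fun x => f (t, x)) Ω :=
  integrableOn_of_continuousOn_closure hΩb (continuousOn_slice_space hf ht)

lemma integrableOn_norm_sub_sq (hΩb : Bornology.IsBounded Ω) (h : IsRegular Ω T d)
    (h' : IsRegular Ω T d') {t : ℝ} (ht : t ∈ Icc 0 T) :
    IntegrableOn (fun x => ‖d t x - d' t x‖ ^ 2) Ω :=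
  integrableOn_slice hΩb ((h.cont.sub h'.cont).norm.pow 2) ht

lemma integrableOn_frob_sub_sq (hΩb : Bornology.IsBounded Ω) (h : IsRegular Ω T d)
    (h' : IsRegular Ω T d') {t : ℝ} (ht : t ∈ Icc 0 T) :
    IntegrableOn (fun x => frob (grad Ω (d t) x - grad Ω (d' t) x) ^ 2) Ω :=
  integrableOn_slice hΩb ((continuous_frob.comp_continuousOn
    (h.continuousOn_grad.sub h'.continuousOn_grad)).pow 2) ht

lemma integrableOn_bend_sub_sq (hΩb : Bornology.IsBounded Ω) (h : IsRegular Ω T d)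
    (h' : IsRegular Ω T d') {t : ℝ} (ht : t ∈ Icc 0 T) :
    IntegrableOn (fun x => ‖bend Ω (d t) x - bend Ω (d' t) x‖ ^ 2) Ω :=
  integrableOn_slice hΩb ((h.continuousOn_bend.sub h'.continuousOn_bend).norm.pow 2) ht

/-- The corrected energy is coercive. -/
lemma le_correctedEnergy (hΩ : IsOpen Ω) (hΩb : Bornology.IsBounded Ω) {m : ℝ}
    (h : IsRegular Ω T d) (h' : IsRegular Ω T d') {t : ℝ} (ht : t ∈ Icc 0 T)
    (hm : ∀ x ∈ Ω, ‖bend Ω (d' t) x‖ ^ 2 ≤ m) :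
    3 / 8 * (∫ x in Ω, frob (grad Ω (d t) x - grad Ω (d' t) x) ^ 2)
      + 1 / 2 * (∫ x in Ω, ‖bend Ω (d t) x - bend Ω (d' t) x‖ ^ 2)
      ≤ correctedEnergy Ω m (d t) (d' t) := by
  have i1 := (integrableOn_frob_sub_sq hΩb h h' ht).const_mul (3 / 8)
  have i2 := (integrableOn_bend_sub_sq hΩb h h' ht).const_mul (1 / 2)
  rw [← integral_const_mul, ← integral_const_mul, ← integral_add i1 i2]
  exact setIntegral_mono_on (i1.add i2) (integrableOn_slice hΩb (continuousOn_density m h h') ht)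
    hΩ.measurableSet fun x hx => density_lower_bound _ _ _ _ (hm x hx)

/-- Only the cross term has no sign: by transposition it is `⟨w, P_skwᵀ b'⟩`, which is bounded by
its absolute value. Applied at time `0`, this produces the initial terms of the theorem. -/
lemma correctedEnergy_le (hΩ : IsOpen Ω) (hΩb : Bornology.IsBounded Ω) (m : ℝ)
    (h : IsRegular Ω T d) (h' : IsRegular Ω T d') {t : ℝ} (ht : t ∈ Icc 0 T) :
    correctedEnergy Ω m (d t) (d' t) ≤ relEnergy Ω (d t) (d' t)
      + m * (∫ x in Ω, ‖d t x - d' t x‖ ^ 2)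
      + ∫ x in Ω, |inner ℝ (d t x - d' t x)
          (act (skw (grad Ω (d t) x) - skw (grad Ω (d' t) x))ᵀ (bend Ω (d' t) x))| := by
  have i1 := (integrableOn_frob_sub_sq hΩb h h' ht).const_mul (1 / 2)
  have i2 := (integrableOn_bend_sub_sq hΩb h h' ht).const_mul (1 / 2)
  have i3 := (integrableOn_norm_sub_sq hΩb h h' ht).const_mul m
  have i4 : IntegrableOn (fun x => |inner ℝ (d t x - d' t x)
      (act (skw (grad Ω (d t) x) - skw (grad Ω (d' t) x))ᵀ (bend Ω (d' t) x))|) Ω := by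
    have hc : Continuous fun p : (M3 × M3) × (E × E) × E => |inner ℝ (p.2.1.1 - p.2.1.2)
        (act (skw p.1.1 - skw p.1.2)ᵀ p.2.2)| := by fun_prop
    exact integrableOn_slice hΩb (hc.comp_continuousOn
      ((h.continuousOn_grad.prodMk h'.continuousOn_grad).prodMk
        ((h.cont.prodMk h'.cont).prodMk h'.continuousOn_bend))) ht
  have e := integral_add ((i1.add i2).add i3) i4
  rw [integral_add' (i1.add i2) i3, integral_add' i1 i2, integral_const_mul, integral_const_mul,
    integral_const_mul] at e
  rw [relEnergy, ← e]
  refine setIntegral_mono_on (integrableOn_slice hΩb (continuousOn_density m h h') ht)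
    (((i1.add i2).add i3).add i4) hΩ.measurableSet fun x hx => ?_
  have := le_abs_self (inner ℝ (d t x - d' t x)
      (act (skw (grad Ω (d t) x) - skw (grad Ω (d' t) x))ᵀ (bend Ω (d' t) x)))
  rw [inner_act_transpose] at this ⊢
  simp only [density, skw_sub, bend, Pi.add_apply] at this ⊢
  linarith

lemma grad_sub (hΩ : IsOpen Ω) {u u' : E → E} {x : E} (hx : x ∈ Ω)
    (hu : DifferentiableAt ℝ u x) (hu' : DifferentiableAt ℝ u' x) :
    grad Ω (fun y => u y - u' y) x = grad Ω u x - grad Ω u' x := by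
  ext i j
  rw [Matrix.sub_apply, grad_apply hΩ _ hx, grad_apply hΩ _ hx, grad_apply hΩ _ hx,
    fderiv_fun_sub hu hu']
  rfl

/-- The two solutions share their boundary values, so the Poincaré inequality applies to their
difference. -/
lemma integral_norm_sub_sq_le (hΩ : IsOpen Ω) (hΩb : Bornology.IsBounded Ω) {c : ℝ}
    (hc : IsPoincareConstant Ω c) (h : IsSolution Ω T v g d) (h' : IsSolution Ω T v g d')
    {t : ℝ} (ht : t ∈ Icc 0 T) :
    (∫ x in Ω, ‖d t x - d' t x‖ ^ 2)
      ≤ c * (∫ x in Ω, frob (grad Ω (d t) x - grad Ω (d' t) x) ^ 2) := by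
  have hd := fun x (hx : x ∈ Ω) => h.regular.differentiableAt hΩ ht hx
  have hd' := fun x (hx : x ∈ Ω) => h'.regular.differentiableAt hΩ ht hx
  have hfd : ∀ x ∈ Ω, fderiv ℝ (fun y => d t y - d' t y) x =
      fderivWithin ℝ (d t) (closure Ω) x - fderivWithin ℝ (d' t) (closure Ω) x := fun x hx => by
    rw [fderiv_fun_sub (hd x hx) (hd' x hx), fderivWithin_closure hΩ _ hx,
      fderivWithin_closure hΩ _ hx]
  have hcont : ContinuousOn (fun x => fderivWithin ℝ (d t) (closure Ω) x
      - fderivWithin ℝ (d' t) (closure Ω) x) (closure Ω) :=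
    (continuousOn_slice_space h.regular.cont_grad ht).sub
      (continuousOn_slice_space h'.regular.cont_grad ht)
  obtain ⟨B, hB⟩ := hΩb.isCompact_closure.exists_bound_of_continuousOn hcont
  have key := hc.2 (fun x => d t x - d' t x)
    ((continuousOn_slice_space h.regular.cont ht).sub (continuousOn_slice_space h'.regular.cont ht))
    ((contDiffOn_succ_iff_fderiv_of_isOpen (n := 0) hΩ).2
      ⟨fun x hx => ((hd x hx).sub (hd' x hx)).differentiableWithinAt, by simp,
        contDiffOn_zero.2 ((hcont.mono subset_closure).congr hfd)⟩)
    ⟨B, fun x hx => by rw [hfd x hx]; exact hB x (subset_closure hx)⟩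
    (fun x hx => by rw [h.boundary t ht x hx, h'.boundary t ht x hx, sub_self])
  refine key.trans_eq ?_
  congr 1
  exact setIntegral_congr_fun hΩ.measurableSet fun x hx => by
    simp only [grad_sub hΩ hx (hd x hx) (hd' x hx)]

/-- The differential inequality for the corrected energy. -/
lemma integral_densityDeriv_le (hΩ : IsOpen Ω) (hΩb : Bornology.IsBounded Ω)
    {c m ℓ : ℝ} (hc : IsPoincareConstant Ω c)
    (h : IsSolution Ω T v g d) (h' : IsSolution Ω T v g d') {t : ℝ} (ht : t ∈ Ioo 0 T)
    (hm0 : 0 ≤ m) (hℓ0 : 0 ≤ ℓ) (hm : ∀ x ∈ Ω, ‖bend Ω (d' t) x‖ ^ 2 ≤ m)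
    (hℓ : ∀ x ∈ Ω, ‖d' t x‖ * frob (grad Ω (dt T d' t) x) + frob (grad Ω (d' t) x) * ‖dt T d' t x‖
          + frob (grad Ω (dt T d' t) x) + ‖dt T d' t x‖ + ‖v x‖ ^ 2 ≤ ℓ) :
    (∫ x in Ω, densityDeriv m (grad Ω (d t) x) (grad Ω (d' t) x) (grad Ω (dt T d t) x)
        (grad Ω (dt T d' t) x) (d t x) (d' t x) (dt T d t x) (dt T d' t x))
      ≤ (4 * c * m ^ 2 + 2 * (1 + c) * ℓ) * correctedEnergy Ω m (d t) (d' t) := by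
  have htI := Ioo_subset_Icc_self ht
  have hdz := fun x (hx : x ∈ Ω) => h.regular.differentiableAt_dt hΩ htI hx
  have hdz' := fun x (hx : x ∈ Ω) => h'.regular.differentiableAt_dt hΩ htI hx
  set φ : E → E := fun x => dt T d t x - dt T d' t x with hφ
  have hφd : ∀ x ∈ Ω, DifferentiableAt ℝ φ x := fun x hx => (hdz x hx).sub (hdz' x hx)
  have hφt : ∀ i, HasBoundedGradient Ω fun x => φ x i := fun i =>
    (h.regular.hasBoundedGradient_dt_coord hΩ hΩb htI i).sub hΩb
      (h'.regular.hasBoundedGradient_dt_coord hΩ hΩb htI i)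
  have hφ0 : ∀ x ∈ frontier Ω, φ x = 0 := fun x hx => by
    simp only [hφ, h.dt_eq_zero htI hx, h'.dt_eq_zero htI hx, sub_self]
  obtain ⟨j, e⟩ := h.weak_form hΩ hΩb ht hφd hφt hφ0
  obtain ⟨j', e'⟩ := h'.weak_form hΩ hΩb ht hφd hφt hφ0
  have iD := integrableOn_slice hΩb (continuousOn_densityDeriv m h.regular h'.regular) htI
  have i1 := integrableOn_norm_sub_sq hΩb h.regular h'.regular htI
  have i2 := integrableOn_frob_sub_sq hΩb h.regular h'.regular htI
  have i3 := integrableOn_bend_sub_sq hΩb h.regular h'.regular htI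
  have iG := (((i2.const_mul (3 / 4)).add (i1.const_mul (3 / 4))).add i3)
  -- Subtracting the two tested equations, whose integrals vanish, does not change the integral of
  -- the derivative, but turns the integrand into the left side of `dissipation_bound`.
  have hmono := setIntegral_mono_on (iD.sub (j.sub j'))
    ((i1.const_mul (3 / 2 * m ^ 2)).add (iG.const_mul ℓ)) hΩ.measurableSet (fun x hx => by
      have hb := dissipation_bound (grad Ω (d t) x - grad Ω (d' t) x) (grad Ω (d' t) x)
        (grad Ω (dt T d' t) x) (d t x - d' t x) (φ x) (d' t x) (dt T d' t x)
        (bend Ω (d t) x - bend Ω (d' t) x) (v x) hm0 (hℓ x hx)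
      refine le_trans (le_of_eq ?_) hb
      simp only [Pi.sub_apply, densityDeriv, energy_algebra]
      rw [grad_sub hΩ hx (hdz x hx) (hdz' x hx)]
      simp only [hφ, bend, ddot_add_left, ddot_sub_left, skw_sub, act_sub_left, inner_add_right,
        inner_sub_right]
      ring)
  rw [integral_sub' iD (j.sub j'), integral_sub' j j', e, e', sub_zero, sub_zero,
    integral_add' (i1.const_mul _) (iG.const_mul ℓ), integral_const_mul, integral_const_mul,
    integral_add' ((i2.const_mul (3 / 4)).add (i1.const_mul (3 / 4))) i3,
    integral_add' (i2.const_mul (3 / 4)) (i1.const_mul (3 / 4)), integral_const_mul,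
    integral_const_mul] at hmono
  refine hmono.trans ?_
  have hP := integral_norm_sub_sq_le hΩ hΩb hc h h' htI
  have hlow := le_correctedEnergy hΩ hΩb h.regular h'.regular htI hm
  have hc0 := hc.1
  have nP : 0 ≤ ∫ x in Ω, frob (grad Ω (d t) x - grad Ω (d' t) x) ^ 2 :=
    integral_nonneg fun _ => sq_nonneg _
  have nβ : 0 ≤ ∫ x in Ω, ‖bend Ω (d t) x - bend Ω (d' t) x‖ ^ 2 :=
    integral_nonneg fun _ => sq_nonneg _
  set IP := ∫ x in Ω, frob (grad Ω (d t) x - grad Ω (d' t) x) ^ 2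
  set Iβ := ∫ x in Ω, ‖bend Ω (d t) x - bend Ω (d' t) x‖ ^ 2
  set Iw := ∫ x in Ω, ‖d t x - d' t x‖ ^ 2
  set Φ := correctedEnergy Ω m (d t) (d' t)
  -- From `Iw ≤ c IP` and `⅜ IP ≤ Φ`: the constant is `(3/2) · (8/3) = 4`.
  have s1 : 3 / 2 * m ^ 2 * Iw ≤ 4 * c * m ^ 2 * Φ := by
    have : 3 / 2 * Iw ≤ 4 * c * Φ := by nlinarith
    nlinarith [mul_le_mul_of_nonneg_left this (sq_nonneg m)]
  -- After `Iw ≤ c IP` the left side is `¾ (1 + c) IP + Iβ`, at most `2 (1 + c)` times `⅜ IP + ½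
  -- Iβ`.
  have s2 : 3 / 4 * IP + 3 / 4 * Iw + Iβ ≤ 2 * (1 + c) * Φ := by
    have : 0 ≤ c * Iβ := mul_nonneg hc0.le nβ
    nlinarith [mul_le_mul_of_nonneg_left hlow (by linarith : 0 ≤ 2 * (1 + c))]
  have s3 := mul_le_mul_of_nonneg_left s2 hℓ0
  linarith

end Energy

/-! ### Gronwall's inequality -/

/-- Gronwall's inequality with a continuous rate. -/
lemma le_mul_exp_of_deriv_le {T a b : ℝ} {Φ Φ' ρ : ℝ → ℝ} (hT : 0 ≤ T)
    (hΦ : ContinuousOn Φ (Icc 0 T)) (hρ : ContinuousOn ρ (Icc 0 T))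
    (hd : ∀ t ∈ Ioo 0 T, HasDerivAt Φ (Φ' t) t)
    (hle : ∀ t ∈ Ioo 0 T, Φ' t ≤ (a + b * ρ t) * Φ t) {t : ℝ} (ht : t ∈ Icc 0 T) :
    Φ t ≤ Φ 0 * Real.exp (a * t + b * ∫ s in (0 : ℝ)..t, ρ s) := by
  set κ : ℝ → ℝ := fun t => a * t + b * ∫ s in (0 : ℝ)..t, ρ s with hκ
  have hκc : ContinuousOn κ (Icc 0 T) := by
    have h := intervalIntegral.continuousOn_primitive_interval (μ := volume) (a := 0) (b := T)
      (f := ρ) (by rw [uIcc_of_le hT]; exact hρ.integrableOn_Icc)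
    rw [uIcc_of_le hT] at h
    exact (continuousOn_const.mul continuousOn_id).add (continuousOn_const.mul h)
  have hκd : ∀ t ∈ Ioo 0 T, HasDerivAt κ (a + b * ρ t) t := by
    intro t ht
    have h1 : HasDerivAt (fun r => ∫ s in (0 : ℝ)..r, ρ s) (ρ t) t :=
      intervalIntegral.integral_hasDerivAt_right
        ((hρ.mono (Icc_subset_Icc_right ht.2.le)).intervalIntegrable_of_Icc ht.1.le)
        ((hρ.mono Ioo_subset_Icc_self).stronglyMeasurableAtFilter isOpen_Ioo t ht)
        (hρ.continuousAt (Icc_mem_nhds ht.1 ht.2))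
    have h2 := ((hasDerivAt_id t).const_mul a).add (h1.const_mul b)
    rw [mul_one] at h2
    exact h2
  have hd' : ∀ t ∈ Ioo 0 T, HasDerivAt (fun t => Φ t * Real.exp (-κ t))
      (Φ' t * Real.exp (-κ t) + Φ t * (Real.exp (-κ t) * -(a + b * ρ t))) t := fun t ht =>
    (hd t ht).mul (hκd t ht).neg.exp
  -- The integrating factor makes `Φ e^{-κ}` nonincreasing whatever the sign of `Φ`. Derivatives are
  -- needed only in the open interval, as continuity covers the end points.
  have hanti : AntitoneOn (fun t => Φ t * Real.exp (-κ t)) (Icc 0 T) := by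
    refine antitoneOn_of_deriv_nonpos (convex_Icc _ _) (hΦ.mul hκc.neg.rexp) ?_ ?_
    · rw [interior_Icc]
      exact fun t ht => (hd' t ht).differentiableAt.differentiableWithinAt
    · rw [interior_Icc]
      intro t ht
      rw [(hd' t ht).deriv]
      have := mul_le_mul_of_nonneg_right (hle t ht) (Real.exp_pos (-κ t)).le
      linarith
  have key := hanti ⟨le_rfl, hT⟩ ht ht.1
  have hκ0 : κ 0 = 0 := by simp [hκ]
  simp only [hκ0, neg_zero, Real.exp_zero, mul_one] at key
  calc Φ t = Φ t * Real.exp (-κ t) * Real.exp (κ t) := by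
        rw [mul_assoc, ← Real.exp_add, neg_add_cancel, Real.exp_zero, mul_one]
    _ ≤ Φ 0 * Real.exp (κ t) := mul_le_mul_of_nonneg_right key (Real.exp_pos _).le

/-! ### Relative energy inequality and uniqueness -/

section Main

variable {Ω : Set E} {T c : ℝ} {v g : E → E} {d d' : ℝ → E → E}

/-- The relative energy inequality. -/
lemma relEnergy_le (hΩ : IsOpen Ω) (hΩb : Bornology.IsBounded Ω) (hv : IsVelocity Ω v)
    (hc : IsPoincareConstant Ω c) (hT : 0 < T) (h : IsSolution Ω T v g d)
    (h' : IsSolution Ω T v g d') {t : ℝ} (ht : t ∈ Icc 0 T) :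
    relEnergy Ω (d t) (d' t) ≤
      2 * (relEnergy Ω (d 0) (d' 0)
          + maxOver (Icc 0 T ×ˢ closure Ω) (fun q : ℝ × E => ‖bend Ω (d' q.1) q.2‖ ^ 2)
            * (∫ x in Ω, ‖d 0 x - d' 0 x‖ ^ 2)
          + (∫ x in Ω, |inner ℝ (d 0 x - d' 0 x)
              (act (skw (grad Ω (d 0) x) - skw (grad Ω (d' 0) x))ᵀ (bend Ω (d' 0) x))|))
        * Real.exp (exponent Ω T c v d' t) := by
  have hK := isCompact_cylinder hΩb T
  have hbend := h'.regular.continuousOn_bend.norm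
  set m := maxOver (Icc 0 T ×ˢ closure Ω) (fun q : ℝ × E => ‖bend Ω (d' q.1) q.2‖ ^ 2) with hm
  set m₄ := maxOver (Icc 0 T ×ˢ closure Ω) (fun q : ℝ × E => ‖bend Ω (d' q.1) q.2‖ ^ 4) with hm₄
  have hm0 : 0 ≤ m := maxOver_nonneg fun _ _ => sq_nonneg _
  have hmm : m ^ 2 ≤ m₄ := maxOver_sq_le hK hbend
  have hmle : ∀ s ∈ Icc 0 T, ∀ x ∈ Ω, ‖bend Ω (d' s) x‖ ^ 2 ≤ m := fun s hs x hx =>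
    le_maxOver hK (f := fun q : ℝ × E => ‖bend Ω (d' q.1) q.2‖ ^ 2) (hbend.pow 2)
      (x := (s, x)) ⟨hs, subset_closure hx⟩
  set rate : ℝ → E → ℝ := fun s x =>
    ‖d' s x‖ * frob (grad Ω (dt T d' s) x) + frob (grad Ω (d' s) x) * ‖dt T d' s x‖
      + frob (grad Ω (dt T d' s) x) + ‖dt T d' s x‖ + ‖v x‖ ^ 2 with hrate
  have hrc : ContinuousOn (fun q : ℝ × E => rate q.1 q.2) (Icc 0 T ×ˢ closure Ω) := by
    have hQ := continuous_frob.comp_continuousOn h'.regular.continuousOn_grad_dt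
    have hA := continuous_frob.comp_continuousOn h'.regular.continuousOn_grad
    have hz := h'.regular.cont_dt.norm
    have hvc : ContinuousOn (fun q : ℝ × E => ‖v q.2‖ ^ 2) (Icc 0 T ×ˢ closure Ω) :=
      ((hv.diff.continuousOn.comp continuousOn_snd fun q hq => hq.2).norm).pow 2
    exact ((((h'.regular.cont.norm.mul hQ).add (hA.mul hz)).add hQ).add hz).add hvc
  set ρ : ℝ → ℝ := fun s => maxOver (closure Ω) (rate s) with hρ
  have hρc : ContinuousOn ρ (Icc 0 T) := continuousOn_maxOver hΩb hrc
  have hrate0 : ∀ s x, 0 ≤ rate s x := fun s x => by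
    have := frob_nonneg (grad Ω (dt T d' s) x)
    have := frob_nonneg (grad Ω (d' s) x)
    positivity
  have hρ0 : ∀ s, 0 ≤ ρ s := fun s => maxOver_nonneg fun x _ => hrate0 s x
  have hlow : ∀ s ∈ Icc 0 T, 0 ≤ correctedEnergy Ω m (d s) (d' s) ∧
      relEnergy Ω (d s) (d' s) ≤ 2 * correctedEnergy Ω m (d s) (d' s) := by
    intro s hs
    have h1 := le_correctedEnergy hΩ hΩb h.regular h'.regular hs (hmle s hs)
    have nP : 0 ≤ ∫ x in Ω, frob (grad Ω (d s) x - grad Ω (d' s) x) ^ 2 :=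
      integral_nonneg fun _ => sq_nonneg _
    have nβ : 0 ≤ ∫ x in Ω, ‖bend Ω (d s) x - bend Ω (d' s) x‖ ^ 2 :=
      integral_nonneg fun _ => sq_nonneg _
    rw [relEnergy]
    constructor <;> linarith
  have hgron := le_mul_exp_of_deriv_le (a := 4 * c * m₄) (b := 2 * (1 + c)) hT.le
    (continuousOn_integral_cylinder hΩ hΩb (continuousOn_density m h.regular h'.regular)) hρc
    (fun s hs => hasDerivAt_correctedEnergy hΩ hΩb m h.regular h'.regular hs)
    (fun s hs => by
      have hsI := Ioo_subset_Icc_self hs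
      refine (integral_densityDeriv_le hΩ hΩb hc h h' hs hm0 (hρ0 s) (hmle s hsI)
        (fun x hx => le_maxOver hΩb.isCompact_closure (continuousOn_slice_space hrc hsI)
          (subset_closure hx))).trans ?_
      -- Enlarging the rate from `m²` to `m₄` is allowed because the corrected energy is
      -- nonnegative.
      refine mul_le_mul_of_nonneg_right ?_ (hlow s hsI).1
      have := mul_le_mul_of_nonneg_left hmm (by linarith [hc.1] : 0 ≤ 4 * c)
      linarith) ht
  have hexp : exponent Ω T c v d' t = 4 * c * m₄ * t + 2 * (1 + c) * ∫ s in (0 : ℝ)..t, ρ s := by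
    rw [exponent]; ring
  rw [hexp]
  have h0 := correctedEnergy_le hΩ hΩb m h.regular h'.regular (t := 0) ⟨le_rfl, hT.le⟩
  have hE := Real.exp_pos (4 * c * m₄ * t + 2 * (1 + c) * ∫ s in (0 : ℝ)..t, ρ s)
  have hgron' : correctedEnergy Ω m (d t) (d' t) ≤ correctedEnergy Ω m (d 0) (d' 0)
      * Real.exp (4 * c * m₄ * t + 2 * (1 + c) * ∫ s in (0 : ℝ)..t, ρ s) := hgron
  have h2 := mul_le_mul_of_nonneg_right h0 hE.le
  rw [mul_assoc]
  -- The factor `2` of the theorem comes from comparing `relEnergy` with the coercive bound: `½ ≤ 2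
  -- · ⅜`.
  linarith [(hlow t ht).2]

/-- Solutions with the same initial values coincide. -/
lemma eq_of_initial_eq (hΩ : IsOpen Ω) (hΩb : Bornology.IsBounded Ω) (hv : IsVelocity Ω v)
    (hc : IsPoincareConstant Ω c) (hT : 0 < T) (h : IsSolution Ω T v g d)
    (h' : IsSolution Ω T v g d') (h0 : ∀ x ∈ Ω, d 0 x = d' 0 x) {t : ℝ} (ht : t ∈ Icc 0 T) {x : E}
    (hx : x ∈ closure Ω) : d t x = d' t x := by
  have hgrad : ∀ y ∈ Ω, grad Ω (d 0) y = grad Ω (d' 0) y := by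
    intro y hy
    have he : d 0 =ᶠ[𝓝 y] d' 0 := by
      filter_upwards [hΩ.mem_nhds hy] with z hz using h0 z hz
    ext i j
    rw [grad_apply hΩ _ hy, grad_apply hΩ _ hy, he.fderiv_eq]
  have hE := relEnergy_le hΩ hΩb hv hc hT h h' ht
  have z1 : ∫ y in Ω, frob (grad Ω (d 0) y - grad Ω (d' 0) y) ^ 2 = 0 :=
    setIntegral_eq_zero_of_forall_eq_zero fun y hy => by simp [hgrad y hy, frob]
  have z2 : ∫ y in Ω, ‖bend Ω (d 0) y - bend Ω (d' 0) y‖ ^ 2 = 0 :=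
    setIntegral_eq_zero_of_forall_eq_zero fun y hy => by simp [bend, hgrad y hy, h0 y hy]
  have z3 : ∫ y in Ω, ‖d 0 y - d' 0 y‖ ^ 2 = 0 :=
    setIntegral_eq_zero_of_forall_eq_zero fun y hy => by simp [h0 y hy]
  have z4 : ∫ y in Ω, |inner ℝ (d 0 y - d' 0 y)
      (act (skw (grad Ω (d 0) y) - skw (grad Ω (d' 0) y))ᵀ (bend Ω (d' 0) y))| = 0 :=
    setIntegral_eq_zero_of_forall_eq_zero fun y hy => by simp [h0 y hy]
  rw [z3, z4, relEnergy, relEnergy, z1, z2] at hE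
  simp only [mul_zero, add_zero, zero_mul] at hE
  have nP : 0 ≤ ∫ y in Ω, frob (grad Ω (d t) y - grad Ω (d' t) y) ^ 2 :=
    integral_nonneg fun _ => sq_nonneg _
  have nβ : 0 ≤ ∫ y in Ω, ‖bend Ω (d t) y - bend Ω (d' t) y‖ ^ 2 :=
    integral_nonneg fun _ => sq_nonneg _
  have hP : ∫ y in Ω, frob (grad Ω (d t) y - grad Ω (d' t) y) ^ 2 = 0 := by linarith
  -- The energy controls only the gradient of the difference; the Poincaré inequality passes to the
  -- difference itself, and continuity from almost everywhere in `Ω` to all of the closure.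
  have hw := integral_norm_sub_sq_le hΩ hΩb hc h h' ht
  rw [hP, mul_zero] at hw
  have hw0 : ∫ y in Ω, ‖d t y - d' t y‖ ^ 2 = 0 :=
    le_antisymm hw (integral_nonneg fun _ => sq_nonneg _)
  have hcont : ContinuousOn (fun y => d t y - d' t y) (closure Ω) :=
    (continuousOn_slice_space h.regular.cont ht).sub (continuousOn_slice_space h'.regular.cont ht)
  have hae := (setIntegral_eq_zero_iff_of_nonneg_ae (ae_of_all _ fun _ => sq_nonneg _)
    (integrableOn_norm_sub_sq hΩb h.regular h'.regular ht)).1 hw0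
  have hzero : EqOn (fun y => ‖d t y - d' t y‖ ^ 2) (fun _ => 0) Ω :=
    Measure.eqOn_open_of_ae_eq hae hΩ ((hcont.mono subset_closure).norm.pow 2) continuousOn_const
  have hΩ0 : EqOn (fun y => d t y - d' t y) (fun _ => 0) Ω := fun y hy => by
    simpa using hzero hy
  have hcl := hΩ0.of_subset_closure hcont continuousOn_const subset_closure subset_rfl hx
  exact sub_eq_zero.1 hcl

end Main

end Director

end

theorem proposition1 (Ω : Set Director.E) (hΩ : IsOpen Ω) (hΩb : Bornology.IsBounded Ω)
    (v : Director.E → Director.E) (hv : Director.IsVelocity Ω v) :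
    (∃ c : ℝ, Director.IsPoincareConstant Ω c) ∧
    ∀ c : ℝ, Director.IsPoincareConstant Ω c →
    ∀ T : ℝ, 0 < T → ∀ (g : Director.E → Director.E) (d d' : ℝ → Director.E → Director.E),
      Director.IsSolution Ω T v g d → Director.IsSolution Ω T v g d' →
      (∀ t ∈ Set.Icc 0 T,
        Director.relEnergy Ω (d t) (d' t) ≤
          2 * (Director.relEnergy Ω (d 0) (d' 0)
              + Director.maxOver (Set.Icc 0 T ×ˢ closure Ω)
                  (fun q : ℝ × Director.E => ‖Director.bend Ω (d' q.1) q.2‖ ^ 2)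
                * (∫ x in Ω, ‖d 0 x - d' 0 x‖ ^ 2)
              + (∫ x in Ω, |inner ℝ (d 0 x - d' 0 x)
                  (Director.act (Director.skw (Director.grad Ω (d 0) x)
                    - Director.skw (Director.grad Ω (d' 0) x))ᵀ (Director.bend Ω (d' 0) x))|))
            * Real.exp (Director.exponent Ω T c v d' t)) ∧
      ((∀ x ∈ Ω, d 0 x = d' 0 x) →
        ∀ t ∈ Set.Icc 0 T, ∀ x ∈ closure Ω, d t x = d' t x) :=
  ⟨Director.exists_isPoincareConstant hΩ hΩb, fun _ hc _ hT _ _ _ h h' =>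
    ⟨fun _ ht => Director.relEnergy_le hΩ hΩb hv hc hT h h' ht,
      fun h0 _ ht _ hx => Director.eq_of_initial_eq hΩ hΩb hv hc hT h h' h0 ht hx⟩⟩
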